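/- Let $(M,g,J)$ be a (non-empty, smooth) almost Hermitian manifold of real dimension four, oriented by $J$, and let $\pi:\mathcal Z\to M$ be its positive twistor space, i.e. the unit sphere bundle of $\Lambda^2_+TM$, where $\Lambda^2TM$ carries the metric $g(v_1\wedge v_2,v_3\wedge v_4)=\frac12\det[g(v_i,v_j)]$. A vector $\sigma\in\Lambda^2T_pM$ is identified with the skew-symmetric endomorphism $K_\sigma$ of $T_pM$ given by $g(K_\sigma X,Y)=2g(\sigma,X\wedge Y)$; thus the fibre $\mathcal Z_p$ is the set of complex structures on $T_pM$ compatible with the metric and the orientation. Let $\omega$ be the section of $\mathcal Z$ with $K_\omega=J$, and let $\times$ be the cross product of $\Lambda^2_+T_pM$. The Levi-Civita connection gives the splitting $T\mathcal Z=\mathcal H\oplus\mathcal V$ into horizontal and vertical subbundles, where $\mathcal V_\sigma$ is the orthogonal complement of $\sigma$ in $\Lambda^2_+T_{\pi(\sigma)}M$; $X^h_\sigma\in\mathcal H_\sigma$ denotes the horizontal lift of $X\in T_{\pi(\sigma)}M$. For $\lambda=a+ib\in\mathbb C\setminus\{0\}$ let $f_\lambda^-:\mathcal Z\to\mathcal Z$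 be the fibre-preserving map $$f_\lambda^-(\sigma)=\frac{2a\sigma-2b\,\sigma\times\omega-2a\,g(\sigma,\omega)\,\omega-\big[(a^2+b^2-1)+(a^2+b^2+1)g(\sigma,\omega)\big]\omega}{(a^2+b^2+1)+(a^2+b^2-1)g(\sigma,\omega)},\qquad \omega=\omega_{\pi(\sigma)},$$ and let $\mathcal J_\lambda^-$ be the almost complex structure on $\mathcal Z$ with $$\mathcal J_\lambda^-X^h_\sigma=(K_{f_\lambda^-(\sigma)}X)^h_\sigma\quad (X\in T_{\pi(\sigma)}M),\qquad \mathcal J_\lambda^-V=\sigma\times V\quad (V\in\mathcal V_\sigma).$$ Let $N(A,B)=[\mathcal J A,\mathcal J B]-\mathcal J[\mathcal J A,B]-\mathcal J[A,\mathcal J B]-[A,B]$, $\mathcal J=\mathcal J_\lambda^-$, be its Nijenhuis tensor. Then for every $\sigma\in\mathcal Z$, every non-zero $X\in T_{\pi(\sigma)}M$ and every non-zero $U\in\mathcal V_\sigma$, the horizontal component of $N(X^h_\sigma,U)$ is non-zero. In particular $\mathcal J_\lambda^-$ is never integrable, i.e. it does not come from a complex structure on $\mathcal Z$: $\mathcal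 Z$ cannot be covered by smooth local charts with values in open subsets of $\mathbb C^3$ whose differentials intertwine $\mathcal J_\lambda^-$ with multiplication by $i$. -/

import Mathlib

open Bundle VectorField Manifold ContDiff Topology Module
noncomputable section

namespace RiemannianGeometry

/-! ### The Levi-Civita connection -/

section LeviCivita

set_option linter.unusedSectionVars false

variable {E : Type*} [NormedAddCommGroup E] [NormedSpace ℝ E] [FiniteDimensional ℝ E]
  {H : Type*} [TopologicalSpace H] (I : ModelWithCorners ℝ E H)
  {M : Type*} [TopologicalSpace M] [ChartedSpace H M] [IsManifold I ∞ M]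
  [RiemannianBundle (fun x : M ↦ TangentSpace I x)]
  [IsContMDiffRiemannianBundle I ∞ E (fun x : M ↦ TangentSpace I x)]

/-- The Koszul expression
`X g(Y,Z) + Y g(X,Z) - Z g(X,Y) + g([X,Y],Z) - g([X,Z],Y) - g([Y,Z],X)`, which is
`2 g(∇_X Y, Z)`, at the point `x`. -/
def koszul (X Y Z : Π x : M, TangentSpace I x) (x : M) : ℝ :=
  mvfderiv I (fun y ↦ inner ℝ (Y y) (Z y)) x (X x)
    + mvfderiv I (fun y ↦ inner ℝ (X y) (Z y)) x (Y x)
    - mvfderiv I (fun y ↦ inner ℝ (X y) (Y y)) x (Z x)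
    + inner ℝ (mlieBracket I X Y x) (Z x)
    - inner ℝ (mlieBracket I X Z x) (Y x)
    - inner ℝ (mlieBracket I Y Z x) (X x)

variable {I}
variable {X Y Z : Π x : M, TangentSpace I x} {x : M}

theorem mdiff_inner (hX : MDiffAt (T% X) x) (hY : MDiffAt (T% Y) x) :
    MDiffAt (fun y ↦ inner ℝ (X y) (Y y)) x :=
  MDifferentiableAt.inner_bundle (F := E) (E := fun x : M ↦ TangentSpace I x) (IB := I) hX hY

theorem koszul_tensorial_left (hY : MDiffAt (T% Y) x) (hZ : MDiffAt (T% Z) x) :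
    TensorialAt I E (fun X ↦ koszul I X Y Z x) x where
  smul {f X} hf hX := by
    have e1 : (fun y ↦ inner ℝ ((f • X) y) (Z y)) = f * fun y ↦ inner ℝ (X y) (Z y) := by
      ext y; simp [inner_smul_left]
    have e2 : (fun y ↦ inner ℝ ((f • X) y) (Y y)) = f * fun y ↦ inner ℝ (X y) (Y y) := by
      ext y; simp [inner_smul_left]
    simp only [koszul, e1, e2]
    rw [mvfderiv_mul hf (mdiff_inner hX hZ), mvfderiv_mul hf (mdiff_inner hX hY),
      mlieBracket_smul_left hf hX, mlieBracket_smul_left hf hX]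
    simp [inner_add_left, inner_smul_left, inner_smul_right]
    ring
  add {X X'} hX hX' := by
    have e1 : (fun y ↦ inner ℝ ((X + X') y) (Z y)) =
        (fun y ↦ inner ℝ (X y) (Z y)) + fun y ↦ inner ℝ (X' y) (Z y) := by
      ext y; simp [inner_add_left]
    have e2 : (fun y ↦ inner ℝ ((X + X') y) (Y y)) =
        (fun y ↦ inner ℝ (X y) (Y y)) + fun y ↦ inner ℝ (X' y) (Y y) := by
      ext y; simp [inner_add_left]
    simp only [koszul, e1, e2]
    rw [mvfderiv_add (mdiff_inner hX hZ) (mdiff_inner hX' hZ),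
      mvfderiv_add (mdiff_inner hX hY) (mdiff_inner hX' hY),
      mlieBracket_add_left hX hX', mlieBracket_add_left hX hX']
    simp [inner_add_left, inner_add_right]
    ring

theorem koszul_tensorial_right (hX : MDiffAt (T% X) x) (hY : MDiffAt (T% Y) x) :
    TensorialAt I E (fun Z ↦ koszul I X Y Z x) x where
  smul {f Z} hf hZ := by
    have e1 : (fun y ↦ inner ℝ (Y y) ((f • Z) y)) = f * fun y ↦ inner ℝ (Y y) (Z y) := by
      ext y; simp [inner_smul_right]
    have e2 : (fun y ↦ inner ℝ (X y) ((f • Z) y)) = f * fun y ↦ inner ℝ (X y) (Z y) := by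
      ext y; simp [inner_smul_right]
    simp only [koszul, e1, e2]
    rw [mvfderiv_mul hf (mdiff_inner hY hZ), mvfderiv_mul hf (mdiff_inner hX hZ),
      mlieBracket_smul_right hf hZ, mlieBracket_smul_right hf hZ]
    simp [inner_add_left, inner_smul_left, inner_smul_right]
    rw [real_inner_comm (Z x) (X x), real_inner_comm (Z x) (Y x)]
    ring
  add {Z Z'} hZ hZ' := by
    have e1 : (fun y ↦ inner ℝ (Y y) ((Z + Z') y)) =
        (fun y ↦ inner ℝ (Y y) (Z y)) + fun y ↦ inner ℝ (Y y) (Z' y) := by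
      ext y; simp [inner_add_right]
    have e2 : (fun y ↦ inner ℝ (X y) ((Z + Z') y)) =
        (fun y ↦ inner ℝ (X y) (Z y)) + fun y ↦ inner ℝ (X y) (Z' y) := by
      ext y; simp [inner_add_right]
    simp only [koszul, e1, e2]
    rw [mvfderiv_add (mdiff_inner hY hZ) (mdiff_inner hY hZ'),
      mvfderiv_add (mdiff_inner hX hZ) (mdiff_inner hX hZ'),
      mlieBracket_add_right hZ hZ', mlieBracket_add_right hZ hZ']
    simp [inner_add_left, inner_add_right]
    ring

theorem koszul_add_middle {Y' : Π x : M, TangentSpace I x} (hX : MDiffAt (T% X) x)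
    (hY : MDiffAt (T% Y) x) (hY' : MDiffAt (T% Y') x) (hZ : MDiffAt (T% Z) x) :
    koszul I X (Y + Y') Z x = koszul I X Y Z x + koszul I X Y' Z x := by
  have e1 : (fun y ↦ inner ℝ ((Y + Y') y) (Z y)) =
      (fun y ↦ inner ℝ (Y y) (Z y)) + fun y ↦ inner ℝ (Y' y) (Z y) := by
    ext y; simp [inner_add_left]
  have e2 : (fun y ↦ inner ℝ (X y) ((Y + Y') y)) =
      (fun y ↦ inner ℝ (X y) (Y y)) + fun y ↦ inner ℝ (X y) (Y' y) := by
    ext y; simp [inner_add_right]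
  simp only [koszul, e1, e2]
  rw [mvfderiv_add (mdiff_inner hY hZ) (mdiff_inner hY' hZ),
    mvfderiv_add (mdiff_inner hX hY) (mdiff_inner hX hY'),
    mlieBracket_add_left hY hY', mlieBracket_add_right hY hY']
  simp [inner_add_left, inner_add_right]
  ring

theorem koszul_smul_middle {f : M → ℝ} (hX : MDiffAt (T% X) x)
    (hf : MDiffAt f x) (hY : MDiffAt (T% Y) x) (hZ : MDiffAt (T% Z) x) :
    koszul I X (f • Y) Z x =
      f x * koszul I X Y Z x + 2 * (mvfderiv I f x (X x) * inner ℝ (Y x) (Z x)) := by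
  have e1 : (fun y ↦ inner ℝ ((f • Y) y) (Z y)) = f * fun y ↦ inner ℝ (Y y) (Z y) := by
    ext y; simp [inner_smul_left]
  have e2 : (fun y ↦ inner ℝ (X y) ((f • Y) y)) = f * fun y ↦ inner ℝ (X y) (Y y) := by
    ext y; simp [inner_smul_right]
  simp only [koszul, e1, e2]
  rw [mvfderiv_mul hf (mdiff_inner hY hZ), mvfderiv_mul hf (mdiff_inner hX hY),
    mlieBracket_smul_left hf hY, mlieBracket_smul_right hf hY]
  simp [inner_add_left, inner_smul_left, inner_smul_right]
  rw [real_inner_comm (X x) (Y x)]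
  ring

/-- `(u, w) ↦ g(∇_u Y, w)` at `x`. -/
def koszulForm (hY : MDiffAt (T% Y) x) :
    TangentSpace I x →L[ℝ] TangentSpace I x →L[ℝ] ℝ :=
  (1 / 2 : ℝ) • TensorialAt.mkHom₂ (fun X Z ↦ koszul I X Y Z x) x
    (fun _ hZ ↦ koszul_tensorial_left hY hZ) (fun _ hX ↦ koszul_tensorial_right hX hY)

theorem koszulForm_apply (hX : MDiffAt (T% X) x) (hY : MDiffAt (T% Y) x)
    (hZ : MDiffAt (T% Z) x) :
    koszulForm hY (X x) (Z x) = (1 / 2) * koszul I X Y Z x := by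
  simp only [koszulForm, _root_.smul_apply, smul_eq_mul]
  rw [TensorialAt.mkHom₂_apply _ _ hX hZ]

open scoped Classical in
/-- `∇Y` at `x`, obtained by solving the Koszul formula for `∇_u Y`. -/
def leviCivitaFun (Y : Π x : M, TangentSpace I x) (x : M) :
    TangentSpace I x →L[ℝ] TangentSpace I x :=
  have : FiniteDimensional ℝ (TangentSpace I x) := inferInstanceAs (FiniteDimensional ℝ E)
  have : CompleteSpace (TangentSpace I x) := FiniteDimensional.complete ℝ _
  if hY : MDiffAt (T% Y) x then
    (InnerProductSpace.toDual ℝ (TangentSpace I x)).symm.toContinuousLinearEquiv.toContinuousLinearMap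
      ∘L koszulForm hY
  else 0

theorem inner_leviCivitaFun (hX : MDiffAt (T% X) x) (hY : MDiffAt (T% Y) x)
    (hZ : MDiffAt (T% Z) x) :
    inner ℝ (leviCivitaFun Y x (X x)) (Z x) = (1 / 2) * koszul I X Y Z x := by
  rw [leviCivitaFun, dif_pos hY, ← koszulForm_apply hX hY hZ]
  simp

theorem inner_leviCivitaFun_extend (hY : MDiffAt (T% Y) x) (u w : TangentSpace I x) :
    inner ℝ (leviCivitaFun Y x u) w =
      (1 / 2) * koszul I (FiberBundle.extend E u) Y (FiberBundle.extend E w) x := by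
  have := inner_leviCivitaFun (FiberBundle.mdifferentiableAt_extend I E u) hY
    (FiberBundle.mdifferentiableAt_extend I E w)
  simpa using this

variable (I M) in
/-- The Levi-Civita connection of a Riemannian manifold, constructed from the Koszul formula. It is
torsion-free and metric by the two theorems below. -/
def leviCivita : CovariantDerivative I E (fun x : M ↦ TangentSpace I x) where
  toFun := leviCivitaFun
  isCovariantDerivativeOnUniv :=
    { add := by
        intro Y Y' x hY hY' _
        ext1 u
        refine ext_inner_right ℝ fun w ↦ ?_
        rw [inner_leviCivitaFun_extend (mdifferentiableAt_add_section hY hY'),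
          koszul_add_middle (FiberBundle.mdifferentiableAt_extend I E u) hY hY'
            (FiberBundle.mdifferentiableAt_extend I E w), _root_.add_apply, inner_add_left,
          inner_leviCivitaFun_extend hY, inner_leviCivitaFun_extend hY']
        ring
      leibniz := by
        intro Y f x hY hf _
        ext1 u
        refine ext_inner_right ℝ fun w ↦ ?_
        rw [inner_leviCivitaFun_extend (hf.smul_section hY),
          koszul_smul_middle (FiberBundle.mdifferentiableAt_extend I E u) hf hY
            (FiberBundle.mdifferentiableAt_extend I E w), _root_.add_apply, inner_add_left,
          _root_.smul_apply, inner_smul_left, inner_leviCivitaFun_extend hY]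
        simp [inner_smul_left]
        ring }

theorem leviCivita_torsion : (leviCivita I M).torsion = 0 := by
  rw [CovariantDerivative.torsion_eq_zero_iff]
  intro X Y x hX hY
  refine ext_inner_right ℝ fun w ↦ ?_
  have hw := FiberBundle.mdifferentiableAt_extend I E w
  have h1 := inner_leviCivitaFun hX hY hw
  have h2 := inner_leviCivitaFun hY hX hw
  simp only [FiberBundle.extend_apply_self] at h1 h2
  change inner ℝ (leviCivitaFun Y x (X x) - leviCivitaFun X x (Y x)) w = _
  rw [inner_sub_left, h1, h2]
  simp only [koszul, mlieBracket_swap_apply (V := Y) (W := X), real_inner_comm, FiberBundle.extend_apply_self]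
  simp
  ring

theorem leviCivita_metric (hX : MDiffAt (T% X) x) (hY : MDiffAt (T% Y) x)
    (hZ : MDiffAt (T% Z) x) :
    mvfderiv I (fun y ↦ inner ℝ (Y y) (Z y)) x (X x) =
      inner ℝ (leviCivita I M Y x (X x)) (Z x) + inner ℝ (Y x) (leviCivita I M Z x (X x)) := by
  have h1 := inner_leviCivitaFun hX hY hZ
  have h2 := inner_leviCivitaFun hX hZ hY
  rw [real_inner_comm] at h2
  change _ = inner ℝ (leviCivitaFun Y x (X x)) (Z x) + inner ℝ (Y x) (leviCivitaFun Z x (X x))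
  rw [h1, h2]
  simp only [koszul, mlieBracket_swap_apply (V := Z) (W := Y), inner_neg_left]
  simp only [real_inner_comm]
  ring

end LeviCivita

section Nijenhuis

variable {E : Type*} [NormedAddCommGroup E] [NormedSpace ℝ E]
  {H : Type*} [TopologicalSpace H] (I : ModelWithCorners ℝ E H)
  {N : Type*} [TopologicalSpace N] [ChartedSpace H N] [IsManifold I ∞ N]

/-- The Nijenhuis tensor at `x` of a field `P` of endomorphisms of the tangent bundle of a manifold,
`N(A,B) = [PA,PB] - P[PA,B] - P[A,PB] + P²[A,B]`, evaluated on the vectors `a`, `b` by means of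
vector fields `A`, `B` that extend them. (For every smooth endomorphism field this expression is
tensorial in `A` and `B`; if `P² = -1` the last term is `-[A,B]`.) -/
def nijenhuis (P : Π x : N, TangentSpace I x → TangentSpace I x) (x : N)
    (a b : TangentSpace I x) : TangentSpace I x :=
  let A : Π y : N, TangentSpace I y := FiberBundle.extend E a
  let B : Π y : N, TangentSpace I y := FiberBundle.extend E b
  let PA : Π y : N, TangentSpace I y := fun y ↦ P y (A y)
  let PB : Π y : N, TangentSpace I y := fun y ↦ P y (B y)
  mlieBracket I PA PB x - P x (mlieBracket I PA B x) - P x (mlieBracket I A PB x)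
    + P x (P x (mlieBracket I A B x))

end Nijenhuis

end RiemannianGeometry

namespace Twistor

open RiemannianGeometry

/-- The model space of a four-manifold. -/
abbrev R4 : Type := EuclideanSpace ℝ (Fin 4)

/-! ### The bundle `End(TM)` and its tangent vectors -/

section Bundle

variable {M : Type*} [TopologicalSpace M] [ChartedSpace R4 M]

/-- `End(T_pM)`. -/
abbrev EndT (p : M) : Type := TangentSpace (𝓡 4) p →L[ℝ] TangentSpace (𝓡 4) p

variable [IsManifold (𝓡 4) ∞ M]

variable (M) in
/-- The total space of the smooth vector bundle `End(TM)`. A two-vector `a` on `T_pM` is represented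
by the skew-symmetric endomorphism `K_a` with `g(K_a X, Y) = 2 g(a, X ∧ Y)`. -/
abbrev EndBundle : Type _ := TotalSpace (R4 →L[ℝ] R4) (fun p : M ↦ EndT p)

/-- The model with corners of the manifold `End(TM)`. -/
abbrev IEnd := (𝓡 4).prod 𝓘(ℝ, R4 →L[ℝ] R4)

/-- The differential `π_*` of the projection `π : End(TM) → M`. -/
def projDeriv (τ : EndBundle M) (w : TangentSpace IEnd τ) : TangentSpace (𝓡 4) τ.proj :=
  mfderiv IEnd (𝓡 4) (TotalSpace.proj : EndBundle M → M) τ w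

/-- `V ∈ End(T_pM)` as a vector at `τ` tangent to the fibre: the velocity of `t ↦ τ + tV`. -/
def vertLift (τ : EndBundle M) (V : EndT τ.proj) : TangentSpace IEnd τ :=
  mfderiv 𝓘(ℝ, ℝ) IEnd (fun t : ℝ ↦ (⟨τ.proj, τ.2 + t • V⟩ : EndBundle M)) 0 (1 : ℝ)

/-- The fibre component of a tangent vector in the local trivialization around `π(τ)`, as an element
of `End(T_{π(τ)}M)`. On vectors tangent to the fibre this is the inverse of `vertLift τ`. -/
def fibreCoord (τ : EndBundle M) (w : TangentSpace IEnd τ) : EndT τ.proj :=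
  (trivializationAt (R4 →L[ℝ] R4) (fun p : M ↦ EndT p) τ.proj).symmL ℝ τ.proj
    (mfderiv IEnd 𝓘(ℝ, R4 →L[ℝ] R4)
      (fun τ' : EndBundle M ↦
        (trivializationAt (R4 →L[ℝ] R4) (fun p : M ↦ EndT p) τ.proj τ').2) τ w)

end Bundle

section Twistor

variable {M : Type*} [TopologicalSpace M] [ChartedSpace R4 M] [IsManifold (𝓡 4) ∞ M]
  [RiemannianBundle (fun x : M ↦ TangentSpace (𝓡 4) x)]
  [IsContMDiffRiemannianBundle (𝓡 4) ∞ R4 (fun x : M ↦ TangentSpace (𝓡 4) x)]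

/-! ### The connection on `End(TM)` and horizontal lifts -/

theorem endCov_tensorial {s : Π p : M, EndT p} {p : M}
    (hs : MDifferentiableAt (𝓡 4) IEnd (fun q ↦ (⟨q, s q⟩ : EndBundle M)) p)
    (X : TangentSpace (𝓡 4) p) :
    TensorialAt (𝓡 4) R4 (fun Y : Π q : M, TangentSpace (𝓡 4) q ↦
      leviCivita (𝓡 4) M (fun q ↦ s q (Y q)) p X - s p (leviCivita (𝓡 4) M Y p X)) p where
  smul {f Y} hf hY := by
    have hsY : MDifferentiableAt (𝓡 4) (𝓡 4).tangent
        (fun q ↦ (⟨q, s q (Y q)⟩ : TangentBundle (𝓡 4) M)) p := hs.clm_bundle_apply hY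
    have e : (fun q ↦ s q ((f • Y) q)) = f • fun q ↦ s q (Y q) := by
      ext1 q; simp
    have l := (leviCivita (𝓡 4) M).isCovariantDerivativeOnUniv
    rw [e, l.leibniz hsY hf, l.leibniz hY hf]
    simp [smul_sub]
  add {Y Y'} hY hY' := by
    have hsY : MDifferentiableAt (𝓡 4) (𝓡 4).tangent
        (fun q ↦ (⟨q, s q (Y q)⟩ : TangentBundle (𝓡 4) M)) p := hs.clm_bundle_apply hY
    have hsY' : MDifferentiableAt (𝓡 4) (𝓡 4).tangent
        (fun q ↦ (⟨q, s q (Y' q)⟩ : TangentBundle (𝓡 4) M)) p := hs.clm_bundle_apply hY'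
    have e : (fun q ↦ s q ((Y + Y') q)) = (fun q ↦ s q (Y q)) + fun q ↦ s q (Y' q) := by
      ext1 q; simp
    have l := (leviCivita (𝓡 4) M).isCovariantDerivativeOnUniv
    rw [e, l.add hsY hsY', l.add hY hY']
    simp
    abel

/-- The covariant derivative `∇_X s` at `p` of a section `s` of `End(TM)`,
`(∇_X s) Y = ∇_X (s Y) - s (∇_X Y)`. -/
def endCov {s : Π p : M, EndT p} {p : M}
    (hs : MDifferentiableAt (𝓡 4) IEnd (fun q ↦ (⟨q, s q⟩ : EndBundle M)) p)
    (X : TangentSpace (𝓡 4) p) : EndT p :=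
  TensorialAt.mkHom _ p (endCov_tensorial hs X)

/-- The horizontal lift `X^h_τ = s_* X - ∇_X s`, where `s` is a local section of `End(TM)` through
`τ`. (The right-hand side does not depend on `s`; here `s` is constant in the local trivialization
around `π(τ)`.) -/
def horLift (τ : EndBundle M) (X : TangentSpace (𝓡 4) τ.proj) : TangentSpace IEnd τ :=
  let sX : TangentSpace IEnd τ := mfderiv (𝓡 4) IEnd
    (fun q ↦ (⟨q, FiberBundle.extend (R4 →L[ℝ] R4) τ.2 q⟩ : EndBundle M)) τ.proj X
  sX - vertLift τ (endCov (FiberBundle.mdifferentiableAt_extend (𝓡 4) (R4 →L[ℝ] R4) τ.2) X)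

/-- The horizontal component `(π_* w)^h` of a tangent vector `w` of `End(TM)`. -/
def horPart (τ : EndBundle M) (w : TangentSpace IEnd τ) : TangentSpace IEnd τ :=
  horLift τ (projDeriv τ w)

/-- The vertical component of a tangent vector `w` of `End(TM)`, as an element of the fibre. -/
def vertPart (τ : EndBundle M) (w : TangentSpace IEnd τ) : EndT τ.proj :=
  fibreCoord τ (w - horPart τ w)

/-! ### Almost Hermitian structures and the twistor space -/

variable (M) in
/-- An almost complex structure `J` on `M` which is compatible with the Riemannian metric. -/
structure AlmostHermitianStructure where
  J : Π p : M, EndT p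
  contMDiff : ContMDiff (𝓡 4) IEnd ∞ (fun p ↦ (⟨p, J p⟩ : EndBundle M))
  sq : ∀ (p : M) (v : TangentSpace (𝓡 4) p), J p (J p v) = -v
  isometry : ∀ (p : M) (v w : TangentSpace (𝓡 4) p), inner ℝ (J p v) (J p w) = inner ℝ v w

/-- Two complex structures on `T_pM` induce the same orientation. The orientation induced by a
complex structure `j` is the one of the bases of the form `(e, je, e', je')`. -/
def SameOrientation {p : M} (j j' : EndT p) : Prop :=
  ∃ b b' : Basis (Fin 4) ℝ (TangentSpace (𝓡 4) p),
    b 1 = j (b 0) ∧ b 3 = j (b 2) ∧ b' 1 = j' (b' 0) ∧ b' 3 = j' (b' 2) ∧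
      b.orientation = b'.orientation

variable (h : AlmostHermitianStructure M)

/-- The (positive) twistor space of `M`, oriented by `J`: the fibre over `p` consists of the complex
structures on `T_pM` compatible with the metric and the orientation, i.e. of the endomorphisms
`K_σ` for the unit vectors `σ` of `Λ²₊T_pM`. -/
def twistorSpace : Set (EndBundle M) :=
  {τ | (∀ v, τ.2 (τ.2 v) = -v) ∧ (∀ v w, inner ℝ (τ.2 v) (τ.2 w) = inner ℝ v w) ∧
    SameOrientation τ.2 (h.J τ.proj)}

/-- The vertical space `𝒱_τ` of the twistor space: the skew-symmetric endomorphisms of `T_{π(τ)}M`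
that anti-commute with `τ`. -/
def vertSpace (τ : EndBundle M) : Set (EndT τ.proj) :=
  {V | (∀ v w, inner ℝ (V v) w = -inner ℝ v (V w)) ∧ V ∘L τ.2 = -(τ.2 ∘L V)}

/-- The tangent space of the twistor space at a point `τ` of it, `ℋ_τ ⊕ 𝒱_τ`, as a subset of the
tangent space of `End(TM)`. -/
def twistorTangent (τ : EndBundle M) : Set (TangentSpace IEnd τ) :=
  {w | ∃ X, ∃ V ∈ vertSpace τ, w = horLift τ X + vertLift τ V}

/-! ### The almost complex structures `𝒥_f` -/

/-- For a fibre-preserving map `f`, the structure `𝒥_f X^h_τ = (K_{f(τ)} X)^h_τ` on horizontal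
vectors and `𝒥_f V = τ × V` on vertical vectors; recall that `K_{τ × V} = K_τ ∘ K_V` for `V ⊥ τ`.
The formula makes sense on all of `End(TM)`, whenever `f` does; at the points of the twistor space
`𝒥_f` maps the tangent space of the twistor space into itself. -/
def acs (f : Π p : M, EndT p → EndT p) (τ : EndBundle M) (w : TangentSpace IEnd τ) :
    TangentSpace IEnd τ :=
  horLift τ (f τ.proj τ.2 (projDeriv τ w)) + vertLift τ (τ.2 ∘L vertPart τ w)

/-- The Nijenhuis tensor of `𝒥_f` at a point `τ` of the twistor space, on vectors `a`, `b` tangent to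
the twistor space. It is computed in the ambient manifold `End(TM)`: there `𝒥_f` is defined near
the twistor space and preserves its tangent spaces, so that, by tensoriality, one may take for `A` and
`B` fields tangent to the twistor space, and the brackets are those of their restrictions. -/
def acsNijenhuis (f : Π p : M, EndT p → EndT p) (τ : EndBundle M) (a b : TangentSpace IEnd τ) :
    TangentSpace IEnd τ :=
  nijenhuis IEnd (acs f) τ a b

/-- `Ψ : W → 𝒵` is the inverse of a holomorphic chart of `(𝒵, 𝒥_f)` with domain `O ∩ 𝒵`: it is a
smooth bijection of the open set `W ⊆ ℂ³` onto `O ∩ 𝒵` whose differentials are isomorphisms onto the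
tangent spaces of `𝒵` and intertwine multiplication by `i` with `𝒥_f`. -/
structure IsHolomorphicParametrization (f : Π p : M, EndT p → EndT p)
    (W : Set (EuclideanSpace ℂ (Fin 3))) (O : Set (EndBundle M))
    (Ψ : EuclideanSpace ℂ (Fin 3) → EndBundle M) : Prop where
  isOpen_source : IsOpen W
  isOpen_target : IsOpen O
  contMDiffOn : ContMDiffOn 𝓘(ℝ, EuclideanSpace ℂ (Fin 3)) IEnd ∞ Ψ W
  bijOn : Set.BijOn Ψ W (O ∩ twistorSpace h)
  injective : ∀ w ∈ W,
    Function.Injective (mfderiv 𝓘(ℝ, EuclideanSpace ℂ (Fin 3)) IEnd Ψ w)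
  range_eq : ∀ w ∈ W,
    Set.range (mfderiv 𝓘(ℝ, EuclideanSpace ℂ (Fin 3)) IEnd Ψ w) = twistorTangent (Ψ w)
  map_I_smul : ∀ w ∈ W, ∀ v : EuclideanSpace ℂ (Fin 3),
    mfderiv 𝓘(ℝ, EuclideanSpace ℂ (Fin 3)) IEnd Ψ w (Complex.I • v) =
      acs f (Ψ w) (mfderiv 𝓘(ℝ, EuclideanSpace ℂ (Fin 3)) IEnd Ψ w v)

/-- `𝒥_f` is integrable: it comes from a complex structure on the twistor space `𝒵`, i.e. `𝒵` is
covered by the domains of holomorphic charts. -/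
def IsIntegrable (f : Π p : M, EndT p → EndT p) : Prop :=
  ∀ σ ∈ twistorSpace h, ∃ W O Ψ, σ ∈ O ∧ IsHolomorphicParametrization h f W O Ψ

/-! ### The maps `f_λ^-` -/

/-- The metric on two-vectors, normalized by `g(v₁ ∧ v₂, v₃ ∧ v₄) = ½ det g(vᵢ, vⱼ)`, in terms of the
skew-symmetric endomorphisms `a = K_α`, `b = K_β`. -/
def endInner {p : M} (a b : EndT p) : ℝ :=
  -(1 / 4) * LinearMap.trace ℝ (TangentSpace (𝓡 4) p) (a ∘L b).toLinearMap

/-- The cross product of `Λ²₊T_pM` in terms of the endomorphisms: `K_{α × β} = ½ [K_α, K_β]`. -/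
def endCross {p : M} (a b : EndT p) : EndT p :=
  (1 / 2 : ℝ) • (a ∘L b - b ∘L a)

/-- The map `f_λ^-`, `λ = a + ib`: with `c = g(σ, ω)`,
`f_λ^-(σ) = {2aσ - 2b σ × ω - 2ac ω - [(a²+b²-1) + (a²+b²+1)c] ω} / [(a²+b²+1) + (a²+b²-1)c]`.
On each fibre this is the stereographic projection from `ω` to `ω^⊥`, followed by multiplication by
`λ` (where `i` acts as `ζ ↦ ω × ζ`) and by the inverse stereographic projection from `-ω`. -/
def fMinus (l : ℂ) (p : M) (σ : EndT p) : EndT p :=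
  let w := h.J p
  let c := endInner σ w
  let r := l.re ^ 2 + l.im ^ 2
  ((r + 1) + (r - 1) * c)⁻¹ •
    ((2 * l.re) • σ - (2 * l.im) • endCross σ w - (2 * l.re * c) • w
      - ((r - 1) + (r + 1) * c) • w)

end Twistor

end Twistor

end

noncomputable section

namespace Twistor

open RiemannianGeometry

/-! ### The fibre map in the quaternions -/

section Algebra

variable {A : Type*} [Ring A] [Algebra ℝ A]

/-- The numerator of `f_λ^-`, as an affine function of `σ` and `c = g(σ, ω)`. -/
def fNum (l : ℂ) (w σ : A) (c : ℝ) : A :=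
  (2 * l.re) • σ - (2 * l.im) • ((1 / 2 : ℝ) • (σ * w - w * σ)) - (2 * l.re * c) • w
    - ((l.re ^ 2 + l.im ^ 2 - 1) + (l.re ^ 2 + l.im ^ 2 + 1) * c) • w

/-- The denominator of `f_λ^-`. -/
def fDen (l : ℂ) (c : ℝ) : ℝ :=
  (l.re ^ 2 + l.im ^ 2 + 1) + (l.re ^ 2 + l.im ^ 2 - 1) * c

/-- The linear part of `fNum`. -/
def fNumLin (l : ℂ) (w V : A) (k : ℝ) : A :=
  (2 * l.re) • V - (2 * l.im) • ((1 / 2 : ℝ) • (V * w - w * V)) - (2 * l.re * k) • w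
    - ((l.re ^ 2 + l.im ^ 2 + 1) * k) • w

/-- The numerator of the derivative of `fNum / fDen` in the direction `V`, where `k = g(V, ω)`. -/
def fDerivNum (l : ℂ) (w σ : A) (c : ℝ) (V : A) (k : ℝ) : A :=
  fDen l c • fNumLin l w V k - ((l.re ^ 2 + l.im ^ 2 - 1) * k) • fNum l w σ c

theorem fNum_add_smul (l : ℂ) (w σ V : A) (c k t : ℝ) :
    fNum l w (σ + t • V) (c + t * k) = fNum l w σ c + t • fNumLin l w V k := by
  simp only [fNum, fNumLin, add_mul, mul_add, smul_mul_assoc, mul_smul_comm]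
  module

theorem fDen_pos {l : ℂ} (hl : l ≠ 0) {c : ℝ} (h1 : -1 ≤ c) (h2 : c ≤ 1) : 0 < fDen l c := by
  have hr : 0 < l.re ^ 2 + l.im ^ 2 := by
    have := Complex.normSq_pos.2 hl
    rwa [Complex.normSq_apply, ← sq, ← sq] at this
  have e : fDen l c = (l.re ^ 2 + l.im ^ 2) * (1 + c) + (1 - c) := by rw [fDen]; ring
  rw [e]
  rcases h1.eq_or_lt with h | h
  · subst h; norm_num
  · have := mul_pos hr (by linarith : 0 < 1 + c)
    linarith

theorem fDerivNum_smul (l : ℂ) (w σ V : A) (c k n : ℝ) :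
    fDerivNum l w σ c (n • V) (n * k) = n • fDerivNum l w σ c V k := by
  simp only [fDerivNum, fNumLin, smul_mul_assoc, mul_smul_comm]
  module

open Quaternion in
/-- The imaginary quaternion `xi + yj + zk`. -/
def imQuat (x y z : ℝ) : ℍ[ℝ] := QuaternionAlgebra.mk 0 x y z

@[simp] theorem re_imQuat (x y z : ℝ) : (imQuat x y z).re = 0 := rfl
@[simp] theorem imI_imQuat (x y z : ℝ) : (imQuat x y z).imI = x := rfl
@[simp] theorem imJ_imQuat (x y z : ℝ) : (imQuat x y z).imJ = y := rfl
@[simp] theorem imK_imQuat (x y z : ℝ) : (imQuat x y z).imK = z := rfl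

open Quaternion in
theorem quaternion_fDerivNum (l : ℂ) {c k m : ℝ} (h : c ^ 2 + k ^ 2 + m ^ 2 = 1) :
    fNum l (imQuat c k m) (imQuat 1 0 0) c *
        fDerivNum l (imQuat c k m) (imQuat 1 0 0) c (imQuat 0 1 0) k +
      fDen l c • fDerivNum l (imQuat c k m) (imQuat 1 0 0) c (imQuat 0 0 1) m = 0 := by
  obtain ⟨a, b⟩ := l
  ext
  · simp [fNum, fDerivNum, fDen, fNumLin]
    linear_combination (-4*b^2*c*k - 4*b^4*c*k + 2*a*k - 2*a*c*k - 12*a*b^2*c*k - 2*a*b^4*k - 2*a*b^4*c*k +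
      4*a^2*k - 8*a^2*c*k - 4*a^2*b^2*k - 12*a^2*b^2*c*k - 12*a^3*c*k - 4*a^3*b^2*k -
      4*a^3*b^2*c*k - 4*a^4*k - 8*a^4*c*k - 2*a^5*k - 2*a^5*c*k) * h
  · simp [fNum, fDerivNum, fDen, fNumLin]
    linear_combination (-2*b*k + 2*b*c*k - 4*b^3*k - 2*b^5*k - 2*b^5*c*k - 4*a*b*k + 4*a*b*c*k - 4*a*b^3*k -
      4*a*b^3*c*k - 4*a^2*b*k - 4*a^2*b^3*k - 4*a^2*b^3*c*k - 4*a^3*b*k - 4*a^3*b*c*k -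
      2*a^4*b*k - 2*a^4*b*c*k) * h
  · simp [fNum, fDerivNum, fDen, fNumLin]
    linear_combination (2*b*c - 2*b*c^2 + 4*b^3*c + 2*b^5*c + 2*b^5*c^2 + 4*a*b*c - 4*a*b*c^2 + 4*a*b^3*c +
      4*a*b^3*c^2 + 4*a^2*b*c + 4*a^2*b^3*c + 4*a^2*b^3*c^2 + 4*a^3*b*c + 4*a^3*b*c^2 +
      2*a^4*b*c + 2*a^4*b*c^2) * h
  · simp [fNum, fDerivNum, fDen, fNumLin]
    linear_combination (-2*a + 2*a*c - 4*a*b^2 - 2*a*b^4 - 2*a*b^4*c - 4*a^2 + 4*a^2*c - 4*a^2*b^2 - 4*a^2*b^2*c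
      - 4*a^3 - 4*a^3*b^2 - 4*a^3*b^2*c - 4*a^4 - 4*a^4*c - 2*a^5 - 2*a^5*c) * h

open Quaternion in
theorem quaternion_normSq_fDerivNum (l : ℂ) {c k m : ℝ} (h : c ^ 2 + k ^ 2 + m ^ 2 = 1) :
    normSq (fDerivNum l (imQuat c k m) (imQuat 1 0 0) c (imQuat 0 0 1) m) =
      4 * (l.re ^ 2 + l.im ^ 2) * fDen l c ^ 2 := by
  obtain ⟨a, b⟩ := l
  have e : fDerivNum ⟨a, b⟩ (imQuat c k m) (imQuat 1 0 0) c (imQuat 0 0 1) m =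
      let P := 2 * a * c + (a ^ 2 + b ^ 2 - 1) + (a ^ 2 + b ^ 2 + 1) * c
      let Q := (2 * a + (a ^ 2 + b ^ 2 + 1)) * m
      let D := (a ^ 2 + b ^ 2 + 1) + (a ^ 2 + b ^ 2 - 1) * c
      let s := (a ^ 2 + b ^ 2 - 1) * m
      imQuat (D * (2 * b * k - Q * c) - s * (2 * a - P * c))
        (D * (-2 * b * c - Q * k) - s * (2 * b * m - P * k))
        (D * (2 * a - Q * m) - s * (-2 * b * k - P * m)) := by
    ext <;> simp [fNum, fDerivNum, fDen, fNumLin] <;> ring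
  rw [e, normSq_def', fDen]
  simp only [re_imQuat, imI_imQuat, imJ_imQuat, imK_imQuat]
  linear_combination (4*b^2 + 4*b^2*m^2 - 8*b^2*c + 4*b^2*c^2 + 8*b^4 + 8*b^4*m^2 - 8*b^4*c^2 + 4*b^6 +
      4*b^6*m^2 + 8*b^6*c + 4*b^6*c^2 + 16*a*b^2*m^2 + 16*a*b^4*m^2 + 4*a^2*m^2 + 8*a^2*b^2 +
      32*a^2*b^2*m^2 - 8*a^2*b^2*c^2 + 8*a^2*b^4 + 12*a^2*b^4*m^2 + 16*a^2*b^4*c +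
      8*a^2*b^4*c^2 + 16*a^3*m^2 + 32*a^3*b^2*m^2 + 24*a^4*m^2 + 4*a^4*b^2 + 12*a^4*b^2*m^2 +
      8*a^4*b^2*c + 4*a^4*b^2*c^2 + 16*a^5*m^2 + 4*a^6*m^2) * h

end Algebra

/-! ### Complex structures on a four-dimensional Euclidean space -/

section LinearAlgebra

theorem det_leftQuaternion (u0 u1 u2 u3 v0 v1 v2 v3 x y z : ℝ) :
    Matrix.det !![u0, -(x * u1 + y * u2 + z * u3), v0, -(x * v1 + y * v2 + z * v3);
      u1, x * u0 - z * u2 + y * u3, v1, x * v0 - z * v2 + y * v3;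
      u2, y * u0 + z * u1 - x * u3, v2, y * v0 + z * v1 - x * v3;
      u3, z * u0 - y * u1 + x * u2, v3, z * v0 - y * v1 + x * v2] =
    (y * (u0 * v3 - v0 * u3 - (v1 * u2 - v2 * u1)) - z * (u0 * v2 - v0 * u2 - (v3 * u1 - v1 * u3))) ^ 2
    + (z * (u0 * v1 - v0 * u1 - (v2 * u3 - v3 * u2)) - x * (u0 * v3 - v0 * u3 - (v1 * u2 - v2 * u1))) ^ 2
    + (x * (u0 * v2 - v0 * u2 - (v3 * u1 - v1 * u3)) - y * (u0 * v1 - v0 * u1 - (v2 * u3 - v3 * u2))) ^ 2 := by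
  simp [Matrix.det_succ_row_zero, Fin.sum_univ_succ, Fin.succAbove]
  ring

theorem det_rightQuaternion (u0 u1 u2 u3 v0 v1 v2 v3 x y z : ℝ) :
    Matrix.det !![u0, -(x * u1 + y * u2 + z * u3), v0, -(x * v1 + y * v2 + z * v3);
      u1, x * u0 + z * u2 - y * u3, v1, x * v0 + z * v2 - y * v3;
      u2, y * u0 - z * u1 + x * u3, v2, y * v0 - z * v1 + x * v3;
      u3, z * u0 + y * u1 - x * u2, v3, z * v0 + y * v1 - x * v2] =
    -((y * (u0 * v3 - v0 * u3 - (u1 * v2 - u2 * v1)) - z * (u0 * v2 - v0 * u2 - (u3 * v1 - u1 * v3))) ^ 2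
    + (z * (u0 * v1 - v0 * u1 - (u2 * v3 - u3 * v2)) - x * (u0 * v3 - v0 * u3 - (u1 * v2 - u2 * v1))) ^ 2
    + (x * (u0 * v2 - v0 * u2 - (u3 * v1 - u1 * v3)) - y * (u0 * v1 - v0 * u1 - (u2 * v3 - u3 * v2))) ^ 2) := by
  simp [Matrix.det_succ_row_zero, Fin.sum_univ_succ, Fin.succAbove]
  ring

variable {E : Type*} [NormedAddCommGroup E] [InnerProductSpace ℝ E]

theorem exists_orthonormalBasis_eq (hE : finrank ℝ E = 4) {v : Fin 4 → E} (hv : Orthonormal ℝ v) :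
    ∃ β : OrthonormalBasis (Fin 4) ℝ E, ⇑β = v := by
  have hc : Fintype.card (Fin 4) = finrank ℝ E := by simp [hE]
  refine ⟨(basisOfOrthonormalOfCardEqFinrank hv hc).toOrthonormalBasis (by simpa using hv), ?_⟩
  simp

theorem skew_of_sq_of_isometry {σ : E →L[ℝ] E} (h1 : ∀ v, σ (σ v) = -v)
    (h2 : ∀ v w, inner ℝ (σ v) (σ w) = inner ℝ v w) (v w : E) :
    inner ℝ (σ v) w = -inner ℝ v (σ w) := by
  rw [← h2 (σ v) w, h1, inner_neg_left]

theorem inner_skew_self {S : E →L[ℝ] E} (h : ∀ v w, inner ℝ (S v) w = -inner ℝ v (S w)) (v : E) :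
    inner ℝ v (S v) = 0 := by
  have := h v v
  rw [real_inner_comm] at this
  linarith

theorem skew_comp_of_anticomm {σ j : E →L[ℝ] E} (hσ : ∀ v w, inner ℝ (σ v) w = -inner ℝ v (σ w))
    (hj : ∀ v w, inner ℝ (j v) w = -inner ℝ v (j w)) (hjσ : ∀ v, j (σ v) = -σ (j v)) (v w : E) :
    inner ℝ ((σ ∘L j) v) w = -inner ℝ v ((σ ∘L j) w) := by
  simp [hσ, hj, hjσ]

theorem orthonormal_quaternion_frame {e i1 i2 i3 : E} {σ j : E →L[ℝ] E}
    (h1 : ∀ v, σ (σ v) = -v) (h2 : ∀ v w, inner ℝ (σ v) (σ w) = inner ℝ v w)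
    (hj : ∀ v w, inner ℝ (j v) w = -inner ℝ v (j w)) (hjσ : ∀ v, j (σ v) = -σ (j v))
    (he : ‖e‖ = 1) (hje : ‖j e‖ = 1) (e1 : i1 = σ e) (e2 : i2 = j e) (e3 : i3 = σ (j e)) :
    Orthonormal ℝ ![e, i1, i2, i3] := by
  subst e1 e2 e3
  have hσ := skew_of_sq_of_isometry h1 h2
  have hn : ∀ v, ‖σ v‖ = ‖v‖ := fun v ↦ by
    rw [norm_eq_sqrt_real_inner, h2, ← norm_eq_sqrt_real_inner]
  have a1 := inner_skew_self hσ e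
  have a2 := inner_skew_self hj e
  have a3 := inner_skew_self hσ (j e)
  have a5 : inner ℝ e (σ (j e)) = 0 := inner_skew_self (skew_comp_of_anticomm hσ hj hjσ) e
  have a4 : inner ℝ (σ e) (j e) = 0 := by rw [hσ, a5, neg_zero]
  simp [orthonormal_vecCons_iff, he, hje, hn, h2, a1, a2, a3, a4, a5, Fin.forall_fin_succ]

theorem exists_quaternion_frame (hE : finrank ℝ E = 4) {σ U : E →L[ℝ] E}
    (h1 : ∀ v, σ (σ v) = -v) (h2 : ∀ v w, inner ℝ (σ v) (σ w) = inner ℝ v w)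
    (hU : ∀ v w, inner ℝ (U v) w = -inner ℝ v (U w)) (hUσ : ∀ v, U (σ v) = -σ (U v))
    (hU0 : U ≠ 0) :
    ∃ (n : ℝ) (j : E →L[ℝ] E) (β : OrthonormalBasis (Fin 4) ℝ E), 0 < n ∧ U = n • j ∧
      (∀ v, j (j v) = -v) ∧ (∀ v, j (σ v) = -σ (j v)) ∧
      β 1 = σ (β 0) ∧ β 2 = j (β 0) ∧ β 3 = σ (j (β 0)) := by
  obtain ⟨e₀, he₀⟩ : ∃ e, U e ≠ 0 := by
    by_contra! h; exact hU0 (ContinuousLinearMap.ext h)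
  have he₀' : e₀ ≠ 0 := by rintro rfl; simp at he₀
  set e : E := ‖e₀‖⁻¹ • e₀ with he
  have hen : ‖e‖ = 1 := by simp [he, norm_smul, he₀']
  have hUe : U e ≠ 0 := by simp [he, he₀, he₀']
  set n := ‖U e‖ with hn
  have hn0 : 0 < n := norm_pos_iff.2 hUe
  set j : E →L[ℝ] E := n⁻¹ • U with hjdef
  have hj : ∀ v w, inner ℝ (j v) w = -inner ℝ v (j w) := fun v w ↦ by
    simp [hjdef, inner_smul_left, inner_smul_right, hU]
  have hjσ : ∀ v, j (σ v) = -σ (j v) := fun v ↦ by simp [hjdef, hUσ]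
  have hje : ‖j e‖ = 1 := by
    simp [hjdef, norm_smul, ← hn, abs_of_pos hn0, hn0.ne']
  obtain ⟨β, hβ⟩ := exists_orthonormalBasis_eq hE
    (orthonormal_quaternion_frame h1 h2 hj hjσ hen hje rfl rfl rfl)
  have b0 : β 0 = e := by simp [hβ]
  have b1 : β 1 = σ e := by simp [hβ]
  have b2 : β 2 = j e := by simp [hβ]
  have b3 : β 3 = σ (j e) := by simp [hβ]
  have hjj : j (j e) = -e := by
    have o := β.orthonormal
    have hσ := skew_of_sq_of_isometry h1 h2
    have key : ∀ v, inner ℝ v (j (j e)) = -inner ℝ (j v) (j e) := fun v ↦ by rw [hj]; simp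
    have o02 := o.2 (show (0 : Fin 4) ≠ 2 by decide)
    have o01 := o.2 (show (0 : Fin 4) ≠ 1 by decide)
    have o03 := o.2 (show (0 : Fin 4) ≠ 3 by decide)
    have o32 := o.2 (show (3 : Fin 4) ≠ 2 by decide)
    simp only [b0, b1, b2, b3] at o02 o01 o03 o32
    have hi : ∀ i, inner ℝ (β i) (j (j e)) = inner ℝ (β i) (-e) := by
      intro i
      fin_cases i
      · simp [b0, key, hen, hje]
      · simp [b1, key, hjσ, o32, real_inner_comm e, o01]
      · simp only [Fin.reduceFinMk, b2, inner_neg_right]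
        rw [inner_skew_self hj, real_inner_comm, o02, neg_zero]
      · simp only [Fin.reduceFinMk, b3, inner_neg_right]
        have := inner_skew_self (skew_comp_of_anticomm hσ hj hjσ) (j e)
        rw [key, hjσ, inner_neg_left]
        rw [real_inner_comm e, o03, real_inner_comm (j e)]
        simpa using this
    rw [← β.sum_repr' (j (j e)), ← β.sum_repr' (-e)]
    exact Finset.sum_congr rfl fun i _ ↦ by rw [hi]
  refine ⟨n, j, β, hn0, ?_, ?_, hjσ, by rw [b1, b0], by rw [b2, b0], by rw [b3, b0]⟩
  · simp [hjdef, smul_smul, hn0.ne']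
  · intro v
    have : j ∘L j = -ContinuousLinearMap.id ℝ E := by
      apply ContinuousLinearMap.coe_injective
      refine β.toBasis.ext fun i ↦ ?_
      rw [OrthonormalBasis.coe_toBasis]
      fin_cases i
      · simp [b0, hjj]
      · simp [b1, hjσ, hjj]
      · simp [b2, hjj]
      · simp [b3, hjσ, hjj]
    simpa using DFunLike.congr_fun this v

theorem det_eq_inner (β : OrthonormalBasis (Fin 4) ℝ E) (v : Fin 4 → E) :
    β.toBasis.det v = Matrix.det (Matrix.of fun i k ↦ inner ℝ (β i) (v k)) := by
  rw [Basis.det_apply]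
  congr 1
  ext i k
  simp [Basis.toMatrix_apply, OrthonormalBasis.repr_apply_apply]

theorem det_nonneg_of_left (β : OrthonormalBasis (Fin 4) ℝ E) {J : E →L[ℝ] E} {x y z : ℝ}
    (h0 : ∀ u, inner ℝ (β 0) (J u) =
      -(x * inner ℝ (β 1) u + y * inner ℝ (β 2) u + z * inner ℝ (β 3) u))
    (h1 : ∀ u, inner ℝ (β 1) (J u) =
      x * inner ℝ (β 0) u - z * inner ℝ (β 2) u + y * inner ℝ (β 3) u)
    (h2 : ∀ u, inner ℝ (β 2) (J u) =
      y * inner ℝ (β 0) u + z * inner ℝ (β 1) u - x * inner ℝ (β 3) u)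
    (h3 : ∀ u, inner ℝ (β 3) (J u) =
      z * inner ℝ (β 0) u - y * inner ℝ (β 1) u + x * inner ℝ (β 2) u)
    {v : Fin 4 → E} (hv1 : v 1 = J (v 0)) (hv3 : v 3 = J (v 2)) :
    0 ≤ β.toBasis.det v := by
  have := det_leftQuaternion (inner ℝ (β 0) (v 0)) (inner ℝ (β 1) (v 0)) (inner ℝ (β 2) (v 0))
    (inner ℝ (β 3) (v 0)) (inner ℝ (β 0) (v 2)) (inner ℝ (β 1) (v 2)) (inner ℝ (β 2) (v 2))
    (inner ℝ (β 3) (v 2)) x y z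
  rw [det_eq_inner]
  refine (le_of_le_of_eq ?_ this.symm).trans_eq ?_
  · positivity
  · congr 1
    ext i k
    fin_cases i <;> fin_cases k <;> simp [hv1, hv3, h0, h1, h2, h3]

theorem det_nonpos_of_right (β : OrthonormalBasis (Fin 4) ℝ E) {J : E →L[ℝ] E} {x y z : ℝ}
    (h0 : ∀ u, inner ℝ (β 0) (J u) =
      -(x * inner ℝ (β 1) u + y * inner ℝ (β 2) u + z * inner ℝ (β 3) u))
    (h1 : ∀ u, inner ℝ (β 1) (J u) =
      x * inner ℝ (β 0) u + z * inner ℝ (β 2) u - y * inner ℝ (β 3) u)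
    (h2 : ∀ u, inner ℝ (β 2) (J u) =
      y * inner ℝ (β 0) u - z * inner ℝ (β 1) u + x * inner ℝ (β 3) u)
    (h3 : ∀ u, inner ℝ (β 3) (J u) =
      z * inner ℝ (β 0) u + y * inner ℝ (β 1) u - x * inner ℝ (β 2) u)
    {v : Fin 4 → E} (hv1 : v 1 = J (v 0)) (hv3 : v 3 = J (v 2)) :
    β.toBasis.det v ≤ 0 := by
  have := det_rightQuaternion (inner ℝ (β 0) (v 0)) (inner ℝ (β 1) (v 0)) (inner ℝ (β 2) (v 0))
    (inner ℝ (β 3) (v 0)) (inner ℝ (β 0) (v 2)) (inner ℝ (β 1) (v 2)) (inner ℝ (β 2) (v 2))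
    (inner ℝ (β 3) (v 2)) x y z
  rw [det_eq_inner]
  refine Eq.trans_le ?_ (this.le.trans ?_)
  · congr 1
    ext i k
    fin_cases i <;> fin_cases k <;> simp [hv1, hv3, h0, h1, h2, h3]
  · rw [neg_nonpos]
    positivity

theorem exists_coeff_of_skew_of_sq (β : OrthonormalBasis (Fin 4) ℝ E) {J : E →L[ℝ] E}
    (h1 : ∀ v, J (J v) = -v) (hJ : ∀ v w, inner ℝ (J v) w = -inner ℝ v (J w)) :
    ∃ ε x y z : ℝ, (ε = 1 ∨ ε = -1) ∧ x ^ 2 + y ^ 2 + z ^ 2 = 1 ∧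
      J (β 0) = x • β 1 + y • β 2 + z • β 3 ∧
      J (β 1) = -x • β 0 + (ε * z) • β 2 - (ε * y) • β 3 ∧
      J (β 2) = -y • β 0 - (ε * z) • β 1 + (ε * x) • β 3 ∧
      J (β 3) = -z • β 0 + (ε * y) • β 1 - (ε * x) • β 2 := by
  have hs := inner_skew_self hJ
  have hk : ∀ i k, inner ℝ (β i) (J (β k)) = -inner ℝ (β k) (J (β i)) := fun i k ↦ by
    rw [← hJ, real_inner_comm]
  have ex : ∀ v, v = inner ℝ (β 0) v • β 0 + inner ℝ (β 1) v • β 1 + inner ℝ (β 2) v • β 2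
      + inner ℝ (β 3) v • β 3 := fun v ↦ by
    conv_lhs => rw [← β.sum_repr' v, Fin.sum_univ_four]
  obtain ⟨x, hx⟩ : ∃ x, x = inner ℝ (β 1) (J (β 0)) := ⟨_, rfl⟩
  obtain ⟨y, hy⟩ : ∃ y, y = inner ℝ (β 2) (J (β 0)) := ⟨_, rfl⟩
  obtain ⟨z, hz⟩ : ∃ z, z = inner ℝ (β 3) (J (β 0)) := ⟨_, rfl⟩
  obtain ⟨p, hp⟩ : ∃ p, p = inner ℝ (β 2) (J (β 1)) := ⟨_, rfl⟩
  obtain ⟨q, hq⟩ : ∃ q, q = inner ℝ (β 3) (J (β 1)) := ⟨_, rfl⟩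
  obtain ⟨s, hs'⟩ : ∃ s, s = inner ℝ (β 3) (J (β 2)) := ⟨_, rfl⟩
  have J0 : J (β 0) = x • β 1 + y • β 2 + z • β 3 := by
    rw [ex (J (β 0)), hs, ← hx, ← hy, ← hz]; module
  have J1 : J (β 1) = -x • β 0 + p • β 2 + q • β 3 := by
    rw [ex (J (β 1)), hs, hk 0 1, ← hx, ← hp, ← hq]; module
  have J2 : J (β 2) = -y • β 0 - p • β 1 + s • β 3 := by
    rw [ex (J (β 2)), hs, hk 0 2, hk 1 2, ← hy, ← hp, ← hs']; module
  have J3 : J (β 3) = -z • β 0 - q • β 1 - s • β 2 := by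
    rw [ex (J (β 3)), hs, hk 0 3, hk 1 3, hk 2 3, ← hz, ← hq, ← hs']; module
  have o : ∀ i k, inner ℝ (β i) (β k) = if i = k then (1 : ℝ) else 0 :=
    fun i k ↦ by simpa using orthonormal_iff_ite.1 β.orthonormal i k
  have sq : ∀ i k, inner ℝ (J (β i)) (J (β k)) = if i = k then (1 : ℝ) else 0 := fun i k ↦ by
    rw [hJ, h1, inner_neg_right, neg_neg, o]
  have e00 := sq 0 0
  have e11 := sq 1 1
  have e22 := sq 2 2
  have e33 := sq 3 3
  have e01 := sq 0 1
  have e02 := sq 0 2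
  have e03 := sq 0 3
  simp only [J0, J1, J2, J3, inner_add_left, inner_add_right, inner_sub_left, inner_sub_right,
    inner_smul_left, inner_smul_right, o] at e00 e11 e22 e33 e01 e02 e03
  simp at e00 e11 e22 e33 e01 e02 e03
  obtain ⟨ε, hε⟩ : ∃ ε, ε = x * s - y * q + z * p := ⟨_, rfl⟩
  have n1 : x ^ 2 + y ^ 2 + z ^ 2 = 1 := by linear_combination e00
  have n2 : s ^ 2 + q ^ 2 + p ^ 2 = 1 := by
    linear_combination (e11 + e22 + e33 - e00) / 2
  have f1 : s = ε * x := by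
    rw [hε]; linear_combination (-s) * n1 - y * e03 + z * e02
  have f2 : q = -(ε * y) := by
    rw [hε]; linear_combination (-q) * n1 - x * e03 + z * e01
  have f3 : p = ε * z := by
    rw [hε]; linear_combination (-p) * n1 - x * e02 + y * e01
  have hε1 : ε ^ 2 = 1 := by
    have : ε ^ 2 * (x ^ 2 + y ^ 2 + z ^ 2) = 1 := by rw [← n2, f1, f2, f3]; ring
    rwa [n1, mul_one] at this
  refine ⟨ε, x, y, z, mul_self_eq_one_iff.1 (by rw [← pow_two, hε1]), n1, J0, ?_, ?_, ?_⟩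
  · rw [J1, f2, f3]; module
  · rw [J2, f1, f3]
  · rw [J3, f1, f2]; module

end LinearAlgebra

section LinearAlgebra

variable {E : Type*} [NormedAddCommGroup E] [InnerProductSpace ℝ E]

theorem exists_coeff_of_sameOrientation {σ j J : E →L[ℝ] E} {β : OrthonormalBasis (Fin 4) ℝ E}
    (h1 : ∀ v, σ (σ v) = -v) (h2 : ∀ v w, inner ℝ (σ v) (σ w) = inner ℝ v w)
    (hj : ∀ v, j (j v) = -v) (hjσ : ∀ v, j (σ v) = -σ (j v))
    (b1 : β 1 = σ (β 0)) (b2 : β 2 = j (β 0)) (b3 : β 3 = σ (j (β 0)))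
    (hJ1 : ∀ v, J (J v) = -v) (hJ2 : ∀ v w, inner ℝ (J v) (J w) = inner ℝ v w)
    {b b' : Basis (Fin 4) ℝ E} (hb1 : b 1 = σ (b 0)) (hb3 : b 3 = σ (b 2))
    (hb'1 : b' 1 = J (b' 0)) (hb'3 : b' 3 = J (b' 2)) (ho : b.orientation = b'.orientation) :
    ∃ x y z : ℝ, x ^ 2 + y ^ 2 + z ^ 2 = 1 ∧ J = x • σ + y • j + z • (σ * j) := by
  have hσ := skew_of_sq_of_isometry h1 h2
  have hJ := skew_of_sq_of_isometry hJ1 hJ2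
  have s0 : σ (β 0) = β 1 := b1.symm
  have s1 : σ (β 1) = -β 0 := by rw [b1, h1]
  have s2 : σ (β 2) = β 3 := by rw [b2, b3]
  have s3 : σ (β 3) = -β 2 := by rw [b3, h1, b2]
  have j0 : j (β 0) = β 2 := b2.symm
  have j1 : j (β 1) = -β 3 := by rw [b1, hjσ, b3]
  have j2 : j (β 2) = -β 0 := by rw [b2, hj]
  have j3 : j (β 3) = β 1 := by rw [b3, hjσ, hj, map_neg, neg_neg, b1]
  have sw : ∀ (S : E →L[ℝ] E) (_ : ∀ v w, inner ℝ (S v) w = -inner ℝ v (S w)) (v u : E),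
      inner ℝ v (S u) = -inner ℝ (S v) u := fun S hS v u ↦ by rw [hS, neg_neg]
  have hbpos : 0 ≤ β.toBasis.det b := by
    refine det_nonneg_of_left β (x := 1) (y := 0) (z := 0) ?_ ?_ ?_ ?_ hb1 hb3 <;> intro u <;>
      rw [sw σ hσ] <;> simp [s0, s1, s2, s3]
  have hprod : 0 < b.det b' := (b.orientation_eq_iff_det_pos b').1 ho
  obtain ⟨ε, x, y, z, hε, hn, J0, J1, J2, J3⟩ := exists_coeff_of_skew_of_sq β hJ1 hJ
  refine ⟨x, y, z, hn, ?_⟩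
  rcases hε with rfl | rfl
  · apply ContinuousLinearMap.coe_injective
    refine β.toBasis.ext fun i ↦ ?_
    rw [OrthonormalBasis.coe_toBasis]
    fin_cases i
    · simp [J0, s0, j0, s2]
    · simp [J1, s1, j1, s3]; module
    · simp [J2, s2, j2, s0]; module
    · simp [J3, s3, j3, s1]; module
  · exfalso
    have hneg : β.toBasis.det b' ≤ 0 := by
      refine det_nonpos_of_right β (x := x) (y := y) (z := z) ?_ ?_ ?_ ?_ hb'1 hb'3 <;> intro u <;>
        rw [sw J hJ] <;>
        simp [J0, J1, J2, J3, inner_add_left, inner_smul_left] <;> ring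
    have hne : β.toBasis.det b ≠ 0 := (β.toBasis.isUnit_det b).ne_zero
    have := Basis.det_mul_det β.toBasis b b'
    have := mul_pos (lt_of_le_of_ne hbpos hne.symm) hprod
    linarith

/-- The metric `endInner`, for the endomorphisms of a Euclidean space. -/
def traceInner (a b : E →L[ℝ] E) : ℝ :=
  -(1 / 4) * LinearMap.trace ℝ E (a ∘L b).toLinearMap

theorem traceInner_add_left (a b c : E →L[ℝ] E) :
    traceInner (a + b) c = traceInner a c + traceInner b c := by
  simp [traceInner, ContinuousLinearMap.add_comp]; ring

theorem traceInner_smul_left (t : ℝ) (a c : E →L[ℝ] E) :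
    traceInner (t • a) c = t * traceInner a c := by
  simp [traceInner, ContinuousLinearMap.smul_comp]; ring

theorem traceInner_comm (a b : E →L[ℝ] E) : traceInner a b = traceInner b a := by
  rw [traceInner, traceInner]
  exact congrArg _ (LinearMap.trace_mul_comm ℝ a.toLinearMap b.toLinearMap)

theorem traceInner_quaternion (hE : finrank ℝ E = 4) {σ j : E →L[ℝ] E}
    (h1 : σ * σ = -1) (hj : j * j = -1) (hjσ : j * σ = -(σ * j)) (x y z : ℝ) :
    traceInner σ (x • σ + y • j + z • (σ * j)) = x ∧
    traceInner j (x • σ + y • j + z • (σ * j)) = y ∧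
    traceInner (σ * j) (x • σ + y • j + z • (σ * j)) = z := by
  have tr_neg : ∀ a : E →L[ℝ] E, LinearMap.trace ℝ E (-a).toLinearMap =
    -LinearMap.trace ℝ E a.toLinearMap := fun a ↦ by simp
  have tr_comm : ∀ a b : E →L[ℝ] E, LinearMap.trace ℝ E (a * b).toLinearMap =
    LinearMap.trace ℝ E (b * a).toLinearMap := fun a b ↦ LinearMap.trace_mul_comm ℝ _ _
  have h11 : traceInner σ σ = 1 := by
    change -(1 / 4) * LinearMap.trace ℝ E (σ * σ).toLinearMap = 1
    rw [h1, tr_neg]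
    have : FiniteDimensional ℝ E := .of_finrank_pos (by omega)
    have : LinearMap.trace ℝ E (1 : E →L[ℝ] E).toLinearMap = 4 := by
      have := LinearMap.trace_one ℝ E
      rw [hE] at this
      exact_mod_cast this
    rw [this]; norm_num
  have h22 : traceInner j j = 1 := by
    rw [← h11]
    change -(1 / 4) * LinearMap.trace ℝ E (j * j).toLinearMap =
      -(1 / 4) * LinearMap.trace ℝ E (σ * σ).toLinearMap
    rw [h1, hj]
  have h33 : traceInner (σ * j) (σ * j) = 1 := by
    rw [← h11]
    change -(1 / 4) * LinearMap.trace ℝ E ((σ * j) * (σ * j)).toLinearMap =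
      -(1 / 4) * LinearMap.trace ℝ E (σ * σ).toLinearMap
    have : (σ * j) * (σ * j) = σ * σ := by
      rw [mul_assoc, ← mul_assoc j, hjσ, neg_mul, mul_assoc, hj]
      simp
    rw [this]
  have h12 : traceInner σ j = 0 := by
    change -(1 / 4) * LinearMap.trace ℝ E (σ * j).toLinearMap = 0
    have := tr_comm j σ
    rw [hjσ, tr_neg] at this
    linarith
  have h13 : traceInner σ (σ * j) = 0 := by
    change -(1 / 4) * LinearMap.trace ℝ E (σ * (σ * j)).toLinearMap = 0
    have := tr_comm σ (σ * j)
    rw [mul_assoc, hjσ, mul_neg, tr_neg] at this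
    linarith
  have h23 : traceInner j (σ * j) = 0 := by
    change -(1 / 4) * LinearMap.trace ℝ E (j * (σ * j)).toLinearMap = 0
    have := tr_comm j (σ * j)
    rw [← mul_assoc, hjσ, neg_mul, tr_neg] at this
    rw [tr_comm j]
    linarith
  refine ⟨?_, ?_, ?_⟩ <;> rw [traceInner_comm] <;>
    simp only [traceInner_add_left, traceInner_smul_left, h11, h22, h33, h12, h13, h23,
      traceInner_comm j σ, traceInner_comm (σ * j) σ, traceInner_comm (σ * j) j] <;> ring

open Quaternion in
/-- The derivative of `f_λ^-` along a fibre anti-commutes with the complex structures of the fibre,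
and it is injective in a strong sense. -/
theorem fDerivNum_anticomm (hE : finrank ℝ E = 4) {l : ℂ} (hl : l ≠ 0) {σ J U : E →L[ℝ] E}
    (h1 : ∀ v, σ (σ v) = -v) (h2 : ∀ v w, inner ℝ (σ v) (σ w) = inner ℝ v w)
    (hJ1 : ∀ v, J (J v) = -v) (hJ2 : ∀ v w, inner ℝ (J v) (J w) = inner ℝ v w)
    {b b' : Basis (Fin 4) ℝ E} (hb1 : b 1 = σ (b 0)) (hb3 : b 3 = σ (b 2))
    (hb'1 : b' 1 = J (b' 0)) (hb'3 : b' 3 = J (b' 2)) (ho : b.orientation = b'.orientation)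
    (hU : ∀ v w, inner ℝ (U v) w = -inner ℝ v (U w)) (hUσ : ∀ v, U (σ v) = -σ (U v))
    (hU0 : U ≠ 0) :
    0 < fDen l (traceInner σ J) ∧
    fNum l J σ (traceInner σ J) * fDerivNum l J σ (traceInner σ J) U (traceInner U J) +
      fDen l (traceInner σ J) •
        fDerivNum l J σ (traceInner σ J) (σ * U) (traceInner (σ * U) J) = 0 ∧
    ∀ X, X ≠ 0 → fDerivNum l J σ (traceInner σ J) (σ * U) (traceInner (σ * U) J) X ≠ 0 := by
  obtain ⟨n, j, β, hn, hUj, hj, hjσ, b1, b2, b3⟩ := exists_quaternion_frame hE h1 h2 hU hUσ hU0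
  obtain ⟨x, y, z, hxyz, hJ⟩ := exists_coeff_of_sameOrientation h1 h2 hj hjσ b1 b2 b3 hJ1 hJ2
    hb1 hb3 hb'1 hb'3 ho
  have m1 : σ * σ = -1 := ContinuousLinearMap.ext fun v ↦ by simp [h1]
  have mj : j * j = -1 := ContinuousLinearMap.ext fun v ↦ by simp [hj]
  have mjσ : j * σ = -(σ * j) := ContinuousLinearMap.ext fun v ↦ by simp [hjσ]
  obtain ⟨t1, t2, t3⟩ := traceInner_quaternion hE m1 mj mjσ x y z
  rw [← hJ] at t1 t2 t3
  have tU : traceInner U J = n * y := by rw [hUj, traceInner_smul_left, t2]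
  have mU : σ * U = n • (σ * j) := by rw [hUj, mul_smul_comm]
  have tσU : traceInner (σ * U) J = n * z := by rw [mU, traceInner_smul_left, t3]
  rw [tU, tσU, t1, mU, hUj, fDerivNum_smul, fDerivNum_smul]
  have hx : x ^ 2 ≤ 1 := by nlinarith [sq_nonneg y, sq_nonneg z]
  have hD : 0 < fDen l x := fDen_pos hl (abs_le.1 (abs_le_one_iff_mul_self_le_one.2 (by nlinarith))).1
    (abs_le.1 (abs_le_one_iff_mul_self_le_one.2 (by nlinarith))).2
  let B : QuaternionAlgebra.Basis (E →L[ℝ] E) (-1 : ℝ) 0 (-1) :=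
    { i := σ, j := j, k := σ * j
      i_mul_i := by rw [m1]; simp
      j_mul_j := by rw [mj]; simp
      i_mul_j := rfl
      j_mul_i := by rw [mjσ]; simp }
  let Φ : ℍ[ℝ] →ₐ[ℝ] (E →L[ℝ] E) := B.liftHom
  have ΦE : ∀ u v w : ℝ, Φ (imQuat u v w) = u • σ + v • j + w • (σ * j) := fun u v w ↦ by
    change algebraMap ℝ _ (0 : ℝ) + u • σ + v • j + w • (σ * j) = _
    rw [map_zero, zero_add]
  have Φσ : Φ (imQuat 1 0 0) = σ := by simp [ΦE]
  have Φj : Φ (imQuat 0 1 0) = j := by simp [ΦE]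
  have Φk : Φ (imQuat 0 0 1) = σ * j := by simp [ΦE]
  have ΦJ : Φ (imQuat x y z) = J := by simp [ΦE, hJ]
  have ΦN : ∀ (w s : ℍ[ℝ]) (c : ℝ), Φ (fNum l w s c) = fNum l (Φ w) (Φ s) c := fun w s c ↦ by
    simp only [fNum, map_sub, map_smul, map_mul]
  have ΦD : ∀ (w s V : ℍ[ℝ]) (c k : ℝ), Φ (fDerivNum l w s c V k) =
      fDerivNum l (Φ w) (Φ s) c (Φ V) k := fun w s V c k ↦ by
    simp only [fDerivNum, fNumLin, map_sub, map_smul, map_mul, ΦN]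
  refine ⟨hD, ?_, ?_⟩
  · have := congrArg Φ (quaternion_fDerivNum l hxyz)
    rw [map_add, map_mul, map_smul, map_zero, ΦN, ΦD, ΦD, Φσ, Φj, Φk, ΦJ] at this
    rw [mul_smul_comm, smul_comm (fDen l x), ← smul_add, this, smul_zero]
  · intro X hX h0
    have hq := quaternion_normSq_fDerivNum l hxyz
    set q : ℍ[ℝ] := fDerivNum l (imQuat x y z) (imQuat 1 0 0) x (imQuat 0 0 1) z with hqdef
    have hr : 0 < l.re ^ 2 + l.im ^ 2 := by
      have := Complex.normSq_pos.2 hl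
      rwa [Complex.normSq_apply, ← sq, ← sq] at this
    have hq0 : q ≠ 0 := by
      rw [← normSq_ne_zero, hq]; positivity
    have hΦq : Φ q X = 0 := by
      rw [hqdef, ΦD, Φσ, Φk, ΦJ]
      simpa [hn.ne'] using h0
    have : Φ (q⁻¹ * q) X = 0 := by
      rw [map_mul, mul_apply_eq_comp, hΦq, map_zero]
    rw [inv_mul_cancel₀ hq0, map_one] at this
    exact hX this

end LinearAlgebra

section Coordinates

variable {M : Type*} [TopologicalSpace M] [ChartedSpace R4 M]

theorem chart_source_mem_nhds {p q : M} (hq : q ∈ (chartAt R4 p).source) :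
    (chartAt R4 p).source ∈ 𝓝 q :=
  (chartAt R4 p).open_source.mem_nhds hq

variable [IsManifold (𝓡 4) ∞ M]

/-- The trivialization of `TM` over the chart at `p`, at the point `q`. -/
abbrev tangentTriv (p q : M) : TangentSpace (𝓡 4) q →L[ℝ] R4 :=
  (trivializationAt R4 (TangentSpace (𝓡 4)) p).continuousLinearMapAt ℝ q

/-- The inverse of the trivialization of `TM` over the chart at `p`, at the point `q`. -/
abbrev tangentTrivSymm (p q : M) : R4 →L[ℝ] TangentSpace (𝓡 4) q :=
  (trivializationAt R4 (TangentSpace (𝓡 4)) p).symmL ℝ q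

theorem tangentTriv_symm {p q : M} (hq : q ∈ (chartAt R4 p).source) (v : R4) :
    tangentTriv p q (tangentTrivSymm p q v) = v :=
  (trivializationAt R4 (TangentSpace (𝓡 4)) p).continuousLinearMapAt_symmL (by simpa using hq) v

theorem tangentTrivSymm_triv {p q : M} (hq : q ∈ (chartAt R4 p).source)
    (v : TangentSpace (𝓡 4) q) :
    tangentTrivSymm p q (tangentTriv p q v) = v :=
  (trivializationAt R4 (TangentSpace (𝓡 4)) p).symmL_continuousLinearMapAt (by simpa using hq) v

theorem tangentTriv_eq_mfderiv {p q : M} (hq : q ∈ (chartAt R4 p).source) :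
    tangentTriv p q = mfderiv (𝓡 4) 𝓘(ℝ, R4) (extChartAt (𝓡 4) p) q :=
  TangentBundle.continuousLinearMapAt_trivializationAt hq

theorem proj_preimage_chart_mem_nhds {p : M} {τ : EndBundle M}
    (hτ : τ.proj ∈ (chartAt R4 p).source) :
    ∀ᶠ τ' : EndBundle M in 𝓝 τ, τ'.proj ∈ (chartAt R4 p).source :=
  (FiberBundle.continuous_proj (R4 →L[ℝ] R4) (fun p : M ↦ EndT p)).continuousAt.eventually
    (chart_source_mem_nhds hτ)

/-- The base coordinates of the chart of `End(TM)` over the chart at `p`. -/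
def baseCoord (p : M) (τ : EndBundle M) : R4 := extChartAt (𝓡 4) p τ.proj

/-- The fibre coordinates of the chart of `End(TM)` over the chart at `p`. -/
def endCoord (p : M) (τ : EndBundle M) : R4 →L[ℝ] R4 :=
  tangentTriv p τ.proj ∘L τ.2 ∘L tangentTrivSymm p τ.proj

theorem trivializationAt_snd (p : M) (τ : EndBundle M) :
    (trivializationAt (R4 →L[ℝ] R4) (fun p : M ↦ EndT p) p τ).2 = endCoord p τ := by
  rw [hom_trivializationAt_apply]
  rfl

theorem extChartAt_endBundle (σ τ : EndBundle M) :
    extChartAt IEnd σ τ = (baseCoord σ.proj τ, endCoord σ.proj τ) := by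
  rw [FiberBundle.extChartAt, ← trivializationAt_snd]
  rfl

theorem contMDiff_proj_endBundle :
    ContMDiff IEnd (𝓡 4) ∞ (TotalSpace.proj : EndBundle M → M) :=
  contMDiff_proj _

theorem contMDiffAt_baseCoord {p : M} {τ : EndBundle M} (hτ : τ.proj ∈ (chartAt R4 p).source) :
    ContMDiffAt IEnd 𝓘(ℝ, R4) ∞ (baseCoord p) τ :=
  (contMDiffAt_extChartAt' hτ).comp τ contMDiff_proj_endBundle.contMDiffAt

theorem contMDiffAt_endCoord {p : M} {τ : EndBundle M} (hτ : τ.proj ∈ (chartAt R4 p).source) :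
    ContMDiffAt IEnd 𝓘(ℝ, R4 →L[ℝ] R4) ∞ (endCoord p) τ := by
  have h : ContMDiffAt IEnd IEnd ∞
      (trivializationAt (R4 →L[ℝ] R4) (fun p : M ↦ EndT p) p) τ := by
    refine (Trivialization.contMDiffOn (IB := 𝓡 4) (n := ∞) _).contMDiffAt
      ((trivializationAt (R4 →L[ℝ] R4) (fun p : M ↦ EndT p) p).open_source.mem_nhds ?_)
    simpa [Trivialization.mem_source] using hτ
  have h2 := contMDiff_snd.contMDiffAt.comp τ h
  refine h2.congr_of_eventuallyEq (.of_forall fun τ' ↦ ?_)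
  simp [trivializationAt_snd]

theorem mem_extChartAt_source_endBundle {σ τ : EndBundle M}
    (hτ : τ.proj ∈ (chartAt R4 σ.proj).source) : τ ∈ (extChartAt IEnd σ).source := by
  have h : τ ∈ (trivializationAt (R4 →L[ℝ] R4) (fun p : M ↦ EndT p) σ.proj).source := by
    simpa [Trivialization.mem_source] using hτ
  simp only [extChartAt_source, FiberBundle.chartedSpace_chartAt]
  simpa [h, Trivialization.coe_fst _ h] using hτ

/-- The base component of a tangent vector of `End(TM)` in the chart over the chart at `p`. -/
def dBase (p : M) (τ : EndBundle M) (w : TangentSpace IEnd τ) : R4 :=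
  mfderiv IEnd 𝓘(ℝ, R4) (baseCoord p) τ w

/-- The fibre component of a tangent vector of `End(TM)` in the chart over the chart at `p`. -/
def dEnd (p : M) (τ : EndBundle M) (w : TangentSpace IEnd τ) : R4 →L[ℝ] R4 :=
  mfderiv IEnd 𝓘(ℝ, R4 →L[ℝ] R4) (endCoord p) τ w

theorem dBase_eq {p : M} {τ : EndBundle M} (hτ : τ.proj ∈ (chartAt R4 p).source)
    (w : TangentSpace IEnd τ) : dBase p τ w = tangentTriv p τ.proj (projDeriv τ w) := by
  rw [tangentTriv_eq_mfderiv hτ, dBase, projDeriv]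
  exact mfderiv_comp_apply (I' := 𝓡 4) τ
    ((contMDiffAt_extChartAt' (n := ∞) hτ).mdifferentiableAt (by simp))
    (contMDiff_proj_endBundle.mdifferentiableAt (by simp)) w

theorem mfderiv_extChartAt_endBundle {σ τ : EndBundle M}
    (hτ : τ.proj ∈ (chartAt R4 σ.proj).source) (w : TangentSpace IEnd τ) :
    mfderiv IEnd 𝓘(ℝ, R4 × (R4 →L[ℝ] R4)) (extChartAt IEnd σ) τ w =
      (dBase σ.proj τ w, dEnd σ.proj τ w) := by
  have e : (extChartAt IEnd σ : EndBundle M → _) =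
      fun τ ↦ (baseCoord σ.proj τ, endCoord σ.proj τ) := funext (extChartAt_endBundle σ)
  have := mfderiv_prodMk ((contMDiffAt_baseCoord hτ).mdifferentiableAt (by simp))
    ((contMDiffAt_endCoord hτ).mdifferentiableAt (by simp))
  rw [e, modelWithCornersSelf_prod, ← chartedSpaceSelf_prod]
  exact DFunLike.congr_fun this w

theorem ext_dBase_dEnd {p : M} {τ : EndBundle M} (hτ : τ.proj ∈ (chartAt R4 p).source)
    {w w' : TangentSpace IEnd τ} (h1 : dBase p τ w = dBase p τ w')
    (h2 : dEnd p τ w = dEnd p τ w') : w = w' := by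
  have hs : τ ∈ (extChartAt IEnd (⟨p, 0⟩ : EndBundle M)).source :=
    mem_extChartAt_source_endBundle hτ
  apply (isInvertible_mfderiv_extChartAt hs).injective
  erw [mfderiv_extChartAt_endBundle (σ := ⟨p, 0⟩) hτ, mfderiv_extChartAt_endBundle (σ := ⟨p, 0⟩) hτ]
  rw [h1, h2]

end Coordinates

section Coordinates

variable {M : Type*} [TopologicalSpace M] [ChartedSpace R4 M] [IsManifold (𝓡 4) ∞ M]

theorem mdifferentiableAt_endCoord {p : M} {τ : EndBundle M}
    (hτ : τ.proj ∈ (chartAt R4 p).source) : MDifferentiableAt IEnd 𝓘(ℝ, R4 →L[ℝ] R4) (endCoord p) τ :=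
  (contMDiffAt_endCoord hτ).mdifferentiableAt (by simp)

theorem mdifferentiableAt_baseCoord {p : M} {τ : EndBundle M}
    (hτ : τ.proj ∈ (chartAt R4 p).source) : MDifferentiableAt IEnd 𝓘(ℝ, R4) (baseCoord p) τ :=
  (contMDiffAt_baseCoord hτ).mdifferentiableAt (by simp)

theorem tangentTriv_injective {p q : M} (hq : q ∈ (chartAt R4 p).source) :
    Function.Injective (tangentTriv p q) :=
  Function.LeftInverse.injective (tangentTrivSymm_triv hq)

theorem mdifferentiableAt_endBundle_fibre (τ : EndBundle M) (V : EndT τ.proj) :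
    MDifferentiableAt 𝓘(ℝ, ℝ) IEnd
      (fun t : ℝ ↦ (⟨τ.proj, τ.2 + t • V⟩ : EndBundle M)) 0 := by
  rw [mdifferentiableAt_totalSpace]
  refine ⟨mdifferentiableAt_const, ?_⟩
  have e : (fun t : ℝ ↦ (trivializationAt (R4 →L[ℝ] R4) (fun p : M ↦ EndT p) τ.proj
      (⟨τ.proj, τ.2 + t • V⟩ : EndBundle M)).2) =
      fun t : ℝ ↦ endCoord τ.proj ⟨τ.proj, τ.2⟩ + t • endCoord τ.proj ⟨τ.proj, V⟩ := by
    funext t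
    rw [trivializationAt_snd]
    ext1 v
    simp [endCoord]
  dsimp only
  rw [e, mdifferentiableAt_iff_differentiableAt]
  fun_prop

theorem dEnd_vertLift {p : M} {τ : EndBundle M} (hτ : τ.proj ∈ (chartAt R4 p).source)
    (V : EndT τ.proj) : dEnd p τ (vertLift τ V) = endCoord p ⟨τ.proj, V⟩ := by
  have h1 := mfderiv_comp_apply_of_eq (x := (0 : ℝ)) (y := τ) (I' := IEnd)
    (I'' := 𝓘(ℝ, R4 →L[ℝ] R4)) (f := fun t : ℝ ↦ (⟨τ.proj, τ.2 + t • V⟩ : EndBundle M))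
    (g := endCoord p)
    (mdifferentiableAt_endCoord hτ) (mdifferentiableAt_endBundle_fibre τ V) (by simp) (1 : ℝ)
  have e : endCoord p ∘ (fun t : ℝ ↦ (⟨τ.proj, τ.2 + t • V⟩ : EndBundle M)) =
      fun t : ℝ ↦ endCoord p ⟨τ.proj, τ.2⟩ + t • endCoord p ⟨τ.proj, V⟩ := by
    funext t
    ext1 v
    simp [endCoord]
  have h2 : HasDerivAt (fun t : ℝ ↦ endCoord p ⟨τ.proj, τ.2⟩ + t • endCoord p ⟨τ.proj, V⟩)
      (endCoord p ⟨τ.proj, V⟩) 0 := by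
    simpa using ((hasDerivAt_id (0 : ℝ)).smul_const (endCoord p ⟨τ.proj, V⟩)).const_add
      (endCoord p ⟨τ.proj, τ.2⟩)
  rw [e, mfderiv_eq_fderiv] at h1
  refine h1.symm.trans ?_
  rw [h2.hasFDerivAt.fderiv]
  exact one_smul ℝ _

theorem projDeriv_vertLift (τ : EndBundle M) (V : EndT τ.proj) :
    projDeriv τ (vertLift τ V) = 0 := by
  have h1 := mfderiv_comp_apply_of_eq (x := (0 : ℝ)) (y := τ) (I' := IEnd) (I'' := 𝓡 4)
    (f := fun t : ℝ ↦ (⟨τ.proj, τ.2 + t • V⟩ : EndBundle M)) (g := TotalSpace.proj)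
    (contMDiff_proj_endBundle.mdifferentiableAt (by simp))
    (mdifferentiableAt_endBundle_fibre τ V) (by simp) (1 : ℝ)
  refine h1.symm.trans ?_
  have e : TotalSpace.proj ∘ (fun t : ℝ ↦ (⟨τ.proj, τ.2 + t • V⟩ : EndBundle M)) =
      fun _ ↦ τ.proj := rfl
  rw [e, mfderiv_const]
  rfl

theorem projDeriv_add (τ : EndBundle M) (w w' : TangentSpace IEnd τ) :
    projDeriv τ (w + w') = projDeriv τ w + projDeriv τ w' :=
  (mfderiv IEnd (𝓡 4) (TotalSpace.proj : EndBundle M → M) τ).map_add w w'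

theorem projDeriv_sub (τ : EndBundle M) (w w' : TangentSpace IEnd τ) :
    projDeriv τ (w - w') = projDeriv τ w - projDeriv τ w' :=
  (mfderiv IEnd (𝓡 4) (TotalSpace.proj : EndBundle M → M) τ).map_sub w w'

theorem dBase_add (p : M) (τ : EndBundle M) (w w' : TangentSpace IEnd τ) :
    dBase p τ (w + w') = dBase p τ w + dBase p τ w' :=
  (mfderiv IEnd 𝓘(ℝ, R4) (baseCoord p) τ).map_add w w'

theorem dBase_sub (p : M) (τ : EndBundle M) (w w' : TangentSpace IEnd τ) :
    dBase p τ (w - w') = dBase p τ w - dBase p τ w' :=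
  (mfderiv IEnd 𝓘(ℝ, R4) (baseCoord p) τ).map_sub w w'

theorem dEnd_add (p : M) (τ : EndBundle M) (w w' : TangentSpace IEnd τ) :
    dEnd p τ (w + w') = dEnd p τ w + dEnd p τ w' :=
  (mfderiv IEnd 𝓘(ℝ, R4 →L[ℝ] R4) (endCoord p) τ).map_add w w'

theorem dEnd_sub (p : M) (τ : EndBundle M) (w w' : TangentSpace IEnd τ) :
    dEnd p τ (w - w') = dEnd p τ w - dEnd p τ w' :=
  (mfderiv IEnd 𝓘(ℝ, R4 →L[ℝ] R4) (endCoord p) τ).map_sub w w'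

theorem dBase_vertLift {p : M} {τ : EndBundle M} (hτ : τ.proj ∈ (chartAt R4 p).source)
    (V : EndT τ.proj) : dBase p τ (vertLift τ V) = 0 := by
  rw [dBase_eq hτ, projDeriv_vertLift, map_zero]

/-- The vector field `W` on `M` is differentiable at `q`. -/
abbrev FieldDiffAt (W : Π q : M, TangentSpace (𝓡 4) q) (q : M) : Prop :=
  MDifferentiableAt (𝓡 4) (𝓡 4).tangent (fun q ↦ (⟨q, W q⟩ : TangentBundle (𝓡 4) M)) q

/-- The vector field `W` on `M` is smooth at `q`. -/
abbrev FieldSmoothAt (W : Π q : M, TangentSpace (𝓡 4) q) (q : M) : Prop :=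
  ContMDiffAt (𝓡 4) (𝓡 4).tangent ∞ (fun q ↦ (⟨q, W q⟩ : TangentBundle (𝓡 4) M)) q

/-- The vector field on `M` which is constant in the trivialization over the chart at `p`. -/
def constField (p : M) (η : R4) (q : M) : TangentSpace (𝓡 4) q := tangentTrivSymm p q η

theorem trivializationAt_tangent_snd {p q : M} (hq : q ∈ (chartAt R4 p).source)
    (v : TangentSpace (𝓡 4) q) :
    (trivializationAt R4 (TangentSpace (𝓡 4)) p (⟨q, v⟩ : TangentBundle (𝓡 4) M)).2 =
      tangentTriv p q v := by
  rw [tangentTriv, Trivialization.continuousLinearMapAt_apply,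
    Trivialization.linearMapAt_apply, if_pos (by simpa using hq)]

theorem mdifferentiableAt_field_iff {p q : M} (hq : q ∈ (chartAt R4 p).source)
    (W : Π q : M, TangentSpace (𝓡 4) q) :
    FieldDiffAt W q ↔ MDifferentiableAt (𝓡 4) 𝓘(ℝ, R4) (fun q' ↦ tangentTriv p q' (W q')) q := by
  refine ((trivializationAt R4 (TangentSpace (𝓡 4)) p).mdifferentiableAt_section_iff (𝓡 4) W
    (by simpa using hq)).trans ?_
  refine Filter.EventuallyEq.mdifferentiableAt_iff ?_
  filter_upwards [chart_source_mem_nhds hq] with q' hq'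
  exact trivializationAt_tangent_snd hq' _

theorem contMDiffAt_field_iff {p q : M} (hq : q ∈ (chartAt R4 p).source)
    (W : Π q : M, TangentSpace (𝓡 4) q) :
    FieldSmoothAt W q ↔ ContMDiffAt (𝓡 4) 𝓘(ℝ, R4) ∞ (fun q' ↦ tangentTriv p q' (W q')) q := by
  refine ((trivializationAt R4 (TangentSpace (𝓡 4)) p).contMDiffAt_section_iff
    (by simpa using hq)).trans ?_
  refine Filter.EventuallyEq.contMDiffAt_iff ?_
  filter_upwards [chart_source_mem_nhds hq] with q' hq'
  exact trivializationAt_tangent_snd hq' _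

theorem contMDiffAt_constField {p q : M} (hq : q ∈ (chartAt R4 p).source) (η : R4) :
    FieldSmoothAt (constField p η) q := by
  rw [contMDiffAt_field_iff hq]
  refine (contMDiffAt_const (c := η)).congr_of_eventuallyEq ?_
  filter_upwards [chart_source_mem_nhds hq] with q' hq'
  exact tangentTriv_symm hq' _

theorem mdifferentiableAt_constField {p q : M} (hq : q ∈ (chartAt R4 p).source) (η : R4) :
    FieldDiffAt (constField p η) q :=
  (contMDiffAt_constField hq η).mdifferentiableAt (by simp)

end Coordinates

section Connection

variable {M : Type*} [TopologicalSpace M] [ChartedSpace R4 M] [IsManifold (𝓡 4) ∞ M]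
  [RiemannianBundle (fun x : M ↦ TangentSpace (𝓡 4) x)]
  [IsContMDiffRiemannianBundle (𝓡 4) ∞ R4 (fun x : M ↦ TangentSpace (𝓡 4) x)]

/-- The Christoffel symbols of the Levi-Civita connection in the chart at `p`. -/
def christoffel (p q : M) (ξ η : R4) : R4 :=
  tangentTriv p q (leviCivita (𝓡 4) M (constField p η) q (tangentTrivSymm p q ξ))

theorem tangentTriv_leviCivita {p q : M} (hq : q ∈ (chartAt R4 p).source)
    {W : Π q : M, TangentSpace (𝓡 4) q} (hW : FieldDiffAt W q) (X : TangentSpace (𝓡 4) q) :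
    tangentTriv p q (leviCivita (𝓡 4) M W q X) =
      mvfderiv (𝓡 4) (fun q' ↦ tangentTriv p q' (W q')) q X
        + christoffel p q (tangentTriv p q X) (tangentTriv p q (W q)) := by
  have l := (leviCivita (𝓡 4) M).isCovariantDerivativeOnUniv
  have T : TensorialAt (𝓡 4) R4 (fun W : Π q : M, TangentSpace (𝓡 4) q ↦
      tangentTriv p q (leviCivita (𝓡 4) M W q X) -
        mvfderiv (𝓡 4) (fun q' ↦ tangentTriv p q' (W q')) q X) q := by
    refine ⟨fun {f W} hf hW ↦ ?_, fun {W W'} hW hW' ↦ ?_⟩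
    · have h1 := (mdifferentiableAt_field_iff hq W).1 hW
      have e : (fun q' ↦ tangentTriv p q' ((f • W) q')) =
          f • fun q' ↦ tangentTriv p q' (W q') := by
        ext1 q'; simp
      rw [l.leibniz hW hf, e, mvfderiv_smul hf h1]
      simp [smul_sub]
    · have h1 := (mdifferentiableAt_field_iff hq W).1 hW
      have h1' := (mdifferentiableAt_field_iff hq W').1 hW'
      have e : (fun q' ↦ tangentTriv p q' ((W + W') q')) =
          (fun q' ↦ tangentTriv p q' (W q')) + fun q' ↦ tangentTriv p q' (W' q') := by
        ext1 q'; simp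
      rw [l.add hW hW', e, mvfderiv_add h1 h1']
      simp
      abel
  have h1 := T.pointwise hW (mdifferentiableAt_constField hq (tangentTriv p q (W q)))
    (tangentTrivSymm_triv hq _).symm
  have e : (fun q' ↦ tangentTriv p q' (constField p (tangentTriv p q (W q)) q')) =ᶠ[𝓝 q]
      fun _ ↦ tangentTriv p q (W q) := by
    filter_upwards [chart_source_mem_nhds hq] with q' hq'
    exact tangentTriv_symm hq' _
  have h2 : mvfderiv (𝓡 4)
      (fun q' ↦ tangentTriv p q' (constField p (tangentTriv p q (W q)) q')) q X = 0 := by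
    have h3 := e.mfderiv_eq (I := 𝓡 4) (I' := 𝓘(ℝ, R4))
    rw [mfderiv_const] at h3
    exact DFunLike.congr_fun h3 X
  rw [h2, sub_zero, sub_eq_iff_eq_add] at h1
  rw [h1, christoffel, tangentTrivSymm_triv hq, add_comm]

theorem christoffel_add_right {p q : M} (hq : q ∈ (chartAt R4 p).source) (ξ η η' : R4) :
    christoffel p q ξ (η + η') = christoffel p q ξ η + christoffel p q ξ η' := by
  have l := (leviCivita (𝓡 4) M).isCovariantDerivativeOnUniv
  have e : constField p (η + η') = constField p η + constField p η' := by
    ext1 q'; simp [constField]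
  rw [christoffel, e, l.add (mdifferentiableAt_constField hq η) (mdifferentiableAt_constField hq η')]
  exact map_add (tangentTriv p q) _ _

theorem christoffel_smul_right {p q : M} (hq : q ∈ (chartAt R4 p).source) (c : ℝ) (ξ η : R4) :
    christoffel p q ξ (c • η) = c • christoffel p q ξ η := by
  have l := (leviCivita (𝓡 4) M).isCovariantDerivativeOnUniv
  have e : constField p (c • η) = (fun _ : M ↦ c) • constField p η := by
    ext1 q'; simp [constField]
  rw [christoffel, e, l.leibniz (mdifferentiableAt_constField hq η) mdifferentiableAt_const]
  simp [christoffel, mvfderiv_const]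

/-- The Christoffel symbols, as a linear map in the second argument. -/
def christoffelCLM (p q : M) (ξ : R4) : R4 →L[ℝ] R4 :=
  ∑ i, ∑ j, ContinuousLinearMap.smulRight (EuclideanSpace.proj j : R4 →L[ℝ] ℝ)
    (ξ i • christoffel p q (EuclideanSpace.basisFun (Fin 4) ℝ i)
      (EuclideanSpace.basisFun (Fin 4) ℝ j))

theorem christoffelCLM_apply {p q : M} (hq : q ∈ (chartAt R4 p).source) (ξ η : R4) :
    christoffelCLM p q ξ η = christoffel p q ξ η := by
  let Φ : R4 →ₗ[ℝ] R4 →ₗ[ℝ] R4 := LinearMap.mk₂ ℝ (christoffel p q)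
    (fun ξ ξ' η ↦ by simp [christoffel]) (fun c ξ η ↦ by simp [christoffel])
    (christoffel_add_right hq) (fun c ξ η ↦ christoffel_smul_right hq c ξ η)
  have hΦ : ∀ ξ η, christoffel p q ξ η = Φ ξ η := fun _ _ ↦ rfl
  rw [hΦ]
  conv_rhs => rw [← (EuclideanSpace.basisFun (Fin 4) ℝ).sum_repr ξ,
    ← (EuclideanSpace.basisFun (Fin 4) ℝ).sum_repr η]
  simp only [map_sum, map_smul, LinearMap.sum_apply, LinearMap.smul_apply]
  simp [christoffelCLM, hΦ, Finset.smul_sum]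
  rw [Finset.sum_comm]

theorem endCoord_endCov {p q : M} (hq : q ∈ (chartAt R4 p).source) {s : Π p : M, EndT p}
    (hs : MDifferentiableAt (𝓡 4) IEnd (fun q ↦ (⟨q, s q⟩ : EndBundle M)) q)
    (X : TangentSpace (𝓡 4) q) :
    endCoord p ⟨q, endCov hs X⟩ =
      dEnd p ⟨q, s q⟩ (mfderiv (𝓡 4) IEnd (fun q ↦ (⟨q, s q⟩ : EndBundle M)) q X)
        + christoffelCLM p q (tangentTriv p q X) ∘L endCoord p ⟨q, s q⟩
        - endCoord p ⟨q, s q⟩ ∘L christoffelCLM p q (tangentTriv p q X) := by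
  ext1 η
  have hη := mdifferentiableAt_constField hq η
  have h1 := TensorialAt.mkHom_apply (endCov_tensorial hs X) hη
  have h2 : FieldDiffAt (fun q ↦ s q (constField p η q)) q := hs.clm_bundle_apply hη
  have h3 : MDifferentiableAt (𝓡 4) 𝓘(ℝ, R4 →L[ℝ] R4) (fun q' ↦ endCoord p ⟨q', s q'⟩) q :=
    (mdifferentiableAt_endCoord (τ := ⟨q, s q⟩) hq).comp q hs
  have h4 : dEnd p ⟨q, s q⟩ (mfderiv (𝓡 4) IEnd (fun q ↦ (⟨q, s q⟩ : EndBundle M)) q X) =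
      mvfderiv (𝓡 4) (fun q' ↦ endCoord p ⟨q', s q'⟩) q X :=
    (mfderiv_comp_apply (I' := IEnd) q (mdifferentiableAt_endCoord (τ := ⟨q, s q⟩) hq) hs X).symm
  have h5 : mvfderiv (𝓡 4) (fun q' ↦ tangentTriv p q' (s q' (constField p η q'))) q X =
      mvfderiv (𝓡 4) (fun q' ↦ endCoord p ⟨q', s q'⟩) q X η := by
    have := mfderiv_comp_apply (I := 𝓡 4) (I' := 𝓘(ℝ, R4 →L[ℝ] R4)) (I'' := 𝓘(ℝ, R4)) q
      (g := fun L : R4 →L[ℝ] R4 ↦ L η)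
      (mdifferentiableAt_iff_differentiableAt.2 (by fun_prop)) h3 X
    refine this.trans ?_
    rw [mfderiv_eq_fderiv]
    exact DFunLike.congr_fun (ContinuousLinearMap.apply ℝ R4 η).fderiv _
  change tangentTriv p q (endCov hs X (constField p η q)) = _
  rw [endCov, h1, map_sub, tangentTriv_leviCivita hq h2, h5, h4]
  have h6 : tangentTriv p q (s q (leviCivita (𝓡 4) M (constField p η) q X)) =
      endCoord p ⟨q, s q⟩ (christoffel p q (tangentTriv p q X) η) := by
    change _ = tangentTriv p q (s q (tangentTrivSymm p q (tangentTriv p q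
      (leviCivita (𝓡 4) M (constField p η) q (tangentTrivSymm p q (tangentTriv p q X))))))
    rw [tangentTrivSymm_triv hq X, tangentTrivSymm_triv hq]
  rw [h6]
  simp only [_root_.sub_apply, _root_.add_apply, ContinuousLinearMap.comp_apply,
    christoffelCLM_apply hq]
  rfl

end Connection

section Lifts

variable {M : Type*} [TopologicalSpace M] [ChartedSpace R4 M] [IsManifold (𝓡 4) ∞ M]

theorem endCoord_fibreCoord (τ : EndBundle M) (w : TangentSpace IEnd τ) :
    endCoord τ.proj ⟨τ.proj, fibreCoord τ w⟩ = dEnd τ.proj τ w := by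
  have e : (fun τ' : EndBundle M ↦
        (trivializationAt (R4 →L[ℝ] R4) (fun p : M ↦ EndT p) τ.proj τ').2) = endCoord τ.proj :=
    funext fun τ' ↦ trivializationAt_snd _ _
  have hb : τ.proj ∈ (trivializationAt (R4 →L[ℝ] R4) (fun p : M ↦ EndT p) τ.proj).baseSet :=
    FiberBundle.mem_baseSet_trivializationAt' _
  have h1 := (trivializationAt (R4 →L[ℝ] R4) (fun p : M ↦ EndT p)
    τ.proj).continuousLinearMapAt_symmL (R := ℝ) hb (dEnd τ.proj τ w)
  rw [Trivialization.continuousLinearMapAt_apply,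
    Trivialization.linearMapAt_apply, if_pos hb, trivializationAt_snd] at h1
  rw [fibreCoord, e]
  exact h1

theorem vertLift_fibreCoord {τ : EndBundle M} {w : TangentSpace IEnd τ}
    (hw : projDeriv τ w = 0) : vertLift τ (fibreCoord τ w) = w := by
  have hτ : τ.proj ∈ (chartAt R4 τ.proj).source := mem_chart_source _ _
  refine ext_dBase_dEnd hτ ?_ ?_
  · rw [dBase_vertLift hτ, dBase_eq hτ, hw, map_zero]
  · rw [dEnd_vertLift hτ, endCoord_fibreCoord]

theorem fibreCoord_vertLift (τ : EndBundle M) (V : EndT τ.proj) :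
    fibreCoord τ (vertLift τ V) = V := by
  have hτ : τ.proj ∈ (chartAt R4 τ.proj).source := mem_chart_source _ _
  have h1 := endCoord_fibreCoord τ (vertLift τ V)
  rw [dEnd_vertLift hτ] at h1
  ext1 v
  have h2 := DFunLike.congr_fun h1 (tangentTriv τ.proj τ.proj v)
  change tangentTriv τ.proj τ.proj (fibreCoord τ (vertLift τ V)
      (tangentTrivSymm τ.proj τ.proj (tangentTriv τ.proj τ.proj v))) =
    tangentTriv τ.proj τ.proj (V (tangentTrivSymm τ.proj τ.proj (tangentTriv τ.proj τ.proj v)))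
    at h2
  rw [tangentTrivSymm_triv hτ] at h2
  exact tangentTriv_injective hτ h2

theorem projDeriv_mfderiv_section {q : M} {s : Π p : M, EndT p}
    (hs : MDifferentiableAt (𝓡 4) IEnd (fun q ↦ (⟨q, s q⟩ : EndBundle M)) q)
    (X : TangentSpace (𝓡 4) q) :
    projDeriv ⟨q, s q⟩ (mfderiv (𝓡 4) IEnd (fun q ↦ (⟨q, s q⟩ : EndBundle M)) q X) = X := by
  have h1 := mfderiv_comp_apply (I' := IEnd) (I'' := 𝓡 4) q (g := TotalSpace.proj)
    (contMDiff_proj_endBundle.mdifferentiableAt (by simp)) hs X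
  refine h1.symm.trans ?_
  have e : TotalSpace.proj ∘ (fun q ↦ (⟨q, s q⟩ : EndBundle M)) = id := rfl
  rw [e, mfderiv_id]
  rfl

theorem tangentTriv_comp {p : M} {τ : EndBundle M} (hτ : τ.proj ∈ (chartAt R4 p).source)
    (X : TangentSpace (𝓡 4) τ.proj) :
    tangentTriv p τ.proj (τ.2 X) = endCoord p τ (tangentTriv p τ.proj X) := by
  change _ = tangentTriv p τ.proj (τ.2 (tangentTrivSymm p τ.proj (tangentTriv p τ.proj X)))
  rw [tangentTrivSymm_triv hτ]

theorem endCoord_comp {p q : M} (hq : q ∈ (chartAt R4 p).source) (a b : EndT q) :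
    endCoord p ⟨q, a ∘L b⟩ = endCoord p ⟨q, a⟩ ∘L endCoord p ⟨q, b⟩ := by
  ext1 η
  exact tangentTriv_comp (τ := ⟨q, a⟩) hq _

end Lifts

section Connection

variable {M : Type*} [TopologicalSpace M] [ChartedSpace R4 M] [IsManifold (𝓡 4) ∞ M]
  [RiemannianBundle (fun x : M ↦ TangentSpace (𝓡 4) x)]
  [IsContMDiffRiemannianBundle (𝓡 4) ∞ R4 (fun x : M ↦ TangentSpace (𝓡 4) x)]

theorem projDeriv_horLift (τ : EndBundle M) (X : TangentSpace (𝓡 4) τ.proj) :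
    projDeriv τ (horLift τ X) = X := by
  obtain ⟨q, e⟩ := τ
  have key : ∀ (s : Π p : M, EndT p)
      (hs : MDifferentiableAt (𝓡 4) IEnd (fun q ↦ (⟨q, s q⟩ : EndBundle M)) q)
      (e : EndT q), s q = e → projDeriv ⟨q, e⟩
        (mfderiv (𝓡 4) IEnd (fun q ↦ (⟨q, s q⟩ : EndBundle M)) q X) = X := by
    rintro s hs e rfl
    exact projDeriv_mfderiv_section hs X
  refine (projDeriv_sub ⟨q, e⟩ _ _).trans ?_
  rw [projDeriv_vertLift, sub_zero]
  exact key _ (FiberBundle.mdifferentiableAt_extend (𝓡 4) (R4 →L[ℝ] R4) e) _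
    (FiberBundle.extend_apply_self _ e)

theorem dBase_horLift {p : M} {τ : EndBundle M} (hτ : τ.proj ∈ (chartAt R4 p).source)
    (X : TangentSpace (𝓡 4) τ.proj) : dBase p τ (horLift τ X) = tangentTriv p τ.proj X := by
  rw [dBase_eq hτ, projDeriv_horLift]

theorem dEnd_horLift {p : M} {τ : EndBundle M} (hτ : τ.proj ∈ (chartAt R4 p).source)
    (X : TangentSpace (𝓡 4) τ.proj) :
    dEnd p τ (horLift τ X) =
      endCoord p τ ∘L christoffelCLM p τ.proj (tangentTriv p τ.proj X) -
        christoffelCLM p τ.proj (tangentTriv p τ.proj X) ∘L endCoord p τ := by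
  obtain ⟨q, e⟩ := τ
  have key : ∀ (s : Π p : M, EndT p)
      (hs : MDifferentiableAt (𝓡 4) IEnd (fun q ↦ (⟨q, s q⟩ : EndBundle M)) q)
      (e : EndT q), s q = e →
        endCoord p ⟨q, endCov hs X⟩ =
      dEnd p ⟨q, e⟩ (mfderiv (𝓡 4) IEnd (fun q ↦ (⟨q, s q⟩ : EndBundle M)) q X)
        + christoffelCLM p q (tangentTriv p q X) ∘L endCoord p ⟨q, e⟩
        - endCoord p ⟨q, e⟩ ∘L christoffelCLM p q (tangentTriv p q X) := by
    rintro s hs e rfl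
    exact endCoord_endCov hτ hs X
  have h1 := key _ (FiberBundle.mdifferentiableAt_extend (𝓡 4) (R4 →L[ℝ] R4) e) _
    (FiberBundle.extend_apply_self _ e)
  refine (dEnd_sub p ⟨q, e⟩ _ _).trans ?_
  rw [dEnd_vertLift hτ]
  dsimp only at h1 ⊢
  rw [h1]
  abel

theorem vertLift_vertPart (τ : EndBundle M) (w : TangentSpace IEnd τ) :
    vertLift τ (vertPart τ w) = w - horPart τ w := by
  refine vertLift_fibreCoord ?_
  rw [projDeriv_sub, horPart, projDeriv_horLift, sub_self]

variable (f : Π p : M, EndT p → EndT p)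

/-- The fibre-preserving map `f` in the coordinates over the chart at `p`. -/
def mapCoord (p : M) (τ : EndBundle M) : R4 →L[ℝ] R4 := endCoord p ⟨τ.proj, f τ.proj τ.2⟩

theorem projDeriv_acs (τ : EndBundle M) (w : TangentSpace IEnd τ) :
    projDeriv τ (acs f τ w) = f τ.proj τ.2 (projDeriv τ w) := by
  rw [acs, projDeriv_add, projDeriv_horLift, projDeriv_vertLift, add_zero]

theorem dBase_acs {p : M} {τ : EndBundle M} (hτ : τ.proj ∈ (chartAt R4 p).source)
    (w : TangentSpace IEnd τ) : dBase p τ (acs f τ w) = mapCoord f p τ (dBase p τ w) := by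
  rw [dBase_eq hτ, dBase_eq hτ, projDeriv_acs, mapCoord]
  exact tangentTriv_comp (τ := ⟨τ.proj, f τ.proj τ.2⟩) hτ _

theorem dEnd_acs {p : M} {τ : EndBundle M} (hτ : τ.proj ∈ (chartAt R4 p).source)
    (w : TangentSpace IEnd τ) :
    dEnd p τ (acs f τ w) =
      (endCoord p τ ∘L christoffelCLM p τ.proj (mapCoord f p τ (dBase p τ w)) -
        christoffelCLM p τ.proj (mapCoord f p τ (dBase p τ w)) ∘L endCoord p τ) +
      endCoord p τ ∘L (dEnd p τ w -
        (endCoord p τ ∘L christoffelCLM p τ.proj (dBase p τ w) -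
          christoffelCLM p τ.proj (dBase p τ w) ∘L endCoord p τ)) := by
  have h1 : endCoord p ⟨τ.proj, vertPart τ w⟩ = dEnd p τ w -
        (endCoord p τ ∘L christoffelCLM p τ.proj (dBase p τ w) -
          christoffelCLM p τ.proj (dBase p τ w) ∘L endCoord p τ) := by
    rw [← dEnd_vertLift hτ, vertLift_vertPart, dEnd_sub, horPart, dEnd_horLift hτ, dBase_eq hτ]
  have h2 : tangentTriv p τ.proj (f τ.proj τ.2 (projDeriv τ w)) =
      mapCoord f p τ (dBase p τ w) := by
    rw [dBase_eq hτ]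
    exact tangentTriv_comp (τ := ⟨τ.proj, f τ.proj τ.2⟩) hτ _
  rw [acs, dEnd_add, dEnd_horLift hτ, dEnd_vertLift hτ, endCoord_comp hτ, h1, h2]

end Connection

section Bracket

variable {E : Type*} [NormedAddCommGroup E] [NormedSpace ℝ E]
  {H : Type*} [TopologicalSpace H] {I : ModelWithCorners ℝ E H}
  {N : Type*} [TopologicalSpace N] [ChartedSpace H N] [IsManifold I ∞ N]

/-- The coordinates of a vector field in the chart at `x₀`. -/
def fieldCoord (I : ModelWithCorners ℝ E H) (x₀ : N) (V : Π x : N, TangentSpace I x) (x : N) : E :=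
  mfderiv I 𝓘(ℝ, E) (extChartAt I x₀) x (V x)

theorem fieldCoord_extend {x₀ : N} (v : TangentSpace I x₀) :
    fieldCoord I x₀ (FiberBundle.extend E v) =ᶠ[𝓝 x₀]
      fun _ ↦ mfderiv I 𝓘(ℝ, E) (extChartAt I x₀) x₀ v := by
  filter_upwards [(chartAt H x₀).open_source.mem_nhds (mem_chart_source H x₀)] with x hx
  have hb : x ∈ (trivializationAt E (TangentSpace I) x₀).baseSet := by simpa using hx
  have hb₀ : x₀ ∈ (trivializationAt E (TangentSpace I) x₀).baseSet := by simp
  rw [fieldCoord, ← TangentBundle.continuousLinearMapAt_trivializationAt hx,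
    ← TangentBundle.continuousLinearMapAt_trivializationAt (mem_chart_source H x₀)]
  have h1 := (trivializationAt E (TangentSpace I) x₀).continuousLinearMapAt_symmL (R := ℝ) hb
    ((trivializationAt E (TangentSpace I) x₀ ⟨x₀, v⟩).2)
  rw [Trivialization.symmL_apply (hb := hb)] at h1
  rw [FiberBundle.extend]
  have h2 : (trivializationAt E (TangentSpace I) x₀).continuousLinearMapAt ℝ x₀ v =
      (trivializationAt E (TangentSpace I) x₀ ⟨x₀, v⟩).2 := by
    rw [Trivialization.continuousLinearMapAt_apply, Trivialization.linearMapAt_apply, if_pos hb₀]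
  exact h1.trans h2.symm

theorem fieldCoord_mlieBracket [I.Boundaryless] {x₀ : N} {V W : Π x : N, TangentSpace I x}
    (hV : MDifferentiableAt I 𝓘(ℝ, E) (fieldCoord I x₀ V) x₀)
    (hW : MDifferentiableAt I 𝓘(ℝ, E) (fieldCoord I x₀ W) x₀) :
    fieldCoord I x₀ (mlieBracket I V W) x₀ =
      mvfderiv I (fieldCoord I x₀ W) x₀ (V x₀) - mvfderiv I (fieldCoord I x₀ V) x₀ (W x₀) := by
  have hx₀ : x₀ ∈ (extChartAt I x₀).source := mem_extChartAt_source x₀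
  have hinv := isInvertible_mfderiv_extChartAt hx₀
  have hl : (extChartAt I x₀).symm (extChartAt I x₀ x₀) = x₀ := extChartAt_to_inv x₀
  have hsymm : ContMDiffAt 𝓘(ℝ, E) I ∞ (extChartAt I x₀).symm (extChartAt I x₀ x₀) :=
    (contMDiffOn_extChartAt_symm x₀).contMDiffAt (extChartAt_target_mem_nhds x₀)
  have hpull : ∀ V : Π x : N, TangentSpace I x,
      mpullbackWithin 𝓘(ℝ, E) I (extChartAt I x₀).symm V (Set.range I)
        =ᶠ[𝓝 (extChartAt I x₀ x₀)] fieldCoord I x₀ V ∘ (extChartAt I x₀).symm := by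
    intro V
    filter_upwards [extChartAt_target_mem_nhds (I := I) x₀] with y hy
    rw [mpullbackWithin_apply, Function.comp_apply, fieldCoord]
    have hys := (extChartAt I x₀).map_target hy
    have h1 := mfderiv_extChartAt_comp_mfderivWithin_extChartAt_symm hy
    have h2 := mfderivWithin_extChartAt_symm_comp_mfderiv_extChartAt hy
    have h3 := ContinuousLinearMap.inverse_eq h2 h1
    rw [h3]
    rfl
  have hcomp : ∀ V : Π x : N, TangentSpace I x,
      MDifferentiableAt I 𝓘(ℝ, E) (fieldCoord I x₀ V) x₀ → ∀ w : TangentSpace I x₀,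
      fderiv ℝ (fieldCoord I x₀ V ∘ (extChartAt I x₀).symm) (extChartAt I x₀ x₀)
        (mfderiv I 𝓘(ℝ, E) (extChartAt I x₀) x₀ w) = mvfderiv I (fieldCoord I x₀ V) x₀ w := by
    intro V hV w
    have hd : MDifferentiableAt 𝓘(ℝ, E) 𝓘(ℝ, E) (fieldCoord I x₀ V ∘ (extChartAt I x₀).symm)
        (extChartAt I x₀ x₀) :=
      MDifferentiableAt.comp _ (by rwa [hl]) (hsymm.mdifferentiableAt (by simp))
    have h1 := mfderiv_comp_apply (I' := 𝓘(ℝ, E)) x₀ hd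
      (mdifferentiableAt_extChartAt (mem_chart_source H x₀)) w
    rw [mfderiv_eq_fderiv] at h1
    refine h1.symm.trans ?_
    have e : (fieldCoord I x₀ V ∘ (extChartAt I x₀).symm) ∘ extChartAt I x₀ =ᶠ[𝓝 x₀]
        fieldCoord I x₀ V := by
      filter_upwards [extChartAt_source_mem_nhds (I := I) x₀] with x hx
      change fieldCoord I x₀ V ((extChartAt I x₀).symm (extChartAt I x₀ x)) = _
      rw [(extChartAt I x₀).left_inv hx]
    exact DFunLike.congr_fun e.mfderiv_eq w
  rw [fieldCoord, ← mlieBracketWithin_univ, mlieBracketWithin_apply]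
  refine (ContinuousLinearMap.IsInvertible.self_apply_inverse hinv _).trans ?_
  have key : ∀ V' W' : E → E,
      V' =ᶠ[𝓝 (extChartAt I x₀ x₀)] fieldCoord I x₀ V ∘ (extChartAt I x₀).symm →
      W' =ᶠ[𝓝 (extChartAt I x₀ x₀)] fieldCoord I x₀ W ∘ (extChartAt I x₀).symm →
      lieBracketWithin ℝ V' W' ((extChartAt I x₀).symm ⁻¹' Set.univ ∩ Set.range I)
        (extChartAt I x₀ x₀) =
      mvfderiv I (fieldCoord I x₀ W) x₀ (V x₀) - mvfderiv I (fieldCoord I x₀ V) x₀ (W x₀) := by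
    intro V' W' e1 e2
    rw [Set.preimage_univ, I.range_eq_univ, Set.univ_inter, lieBracketWithin_univ,
      lieBracket_eq]
    dsimp only
    rw [e1.fderiv_eq, e2.fderiv_eq, e1.eq_of_nhds, e2.eq_of_nhds, ← hcomp V hV, ← hcomp W hW]
    simp only [Function.comp_apply, hl]
    rfl
  exact key _ _ (hpull V) (hpull W)

end Bracket

/-- The matrix obtained by contracting a vector with a bilinear map given by its coefficients. -/
def contractCoeff (G : R4 × (Fin 4 → Fin 4 → R4)) : R4 →L[ℝ] R4 :=
  ∑ i, ∑ j, ContinuousLinearMap.smulRight (EuclideanSpace.proj j : R4 →L[ℝ] ℝ) (G.1 i • G.2 i j)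

theorem differentiable_contractCoeff : Differentiable ℝ contractCoeff := by
  unfold contractCoeff
  fun_prop

section Pi

variable {E : Type*} [NormedAddCommGroup E] [NormedSpace ℝ E]
  {H : Type*} [TopologicalSpace H] {I : ModelWithCorners ℝ E H}
  {N : Type*} [TopologicalSpace N] [ChartedSpace H N]

theorem mdifferentiableAt_pi {ι : Type*} [Fintype ι] {F : ι → Type*}
    [∀ i, NormedAddCommGroup (F i)] [∀ i, NormedSpace ℝ (F i)] {f : N → ∀ i, F i} {x : N}
    (hf : ∀ i, MDifferentiableAt I 𝓘(ℝ, F i) (fun x ↦ f x i) x) :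
    MDifferentiableAt I 𝓘(ℝ, ∀ i, F i) f x := by
  rw [mdifferentiableAt_iff]
  exact ⟨continuousAt_pi.2 fun i ↦ (hf i).continuousAt,
    differentiableWithinAt_pi.2 fun i ↦ ((mdifferentiableAt_iff _ _).1 (hf i)).2⟩

end Pi

section ConstField

variable {M : Type*} [TopologicalSpace M] [ChartedSpace R4 M] [IsManifold (𝓡 4) ∞ M]

theorem mvfderiv_constField {p q : M} (hq : q ∈ (chartAt R4 p).source) {h : M → ℝ}
    (hh : MDifferentiableAt (𝓡 4) 𝓘(ℝ, ℝ) h q) (ξ : R4) :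
    mvfderiv (𝓡 4) h q (constField p ξ q) =
      fderiv ℝ (h ∘ (extChartAt (𝓡 4) p).symm) (extChartAt (𝓡 4) p q) ξ := by
  have hq' : q ∈ (extChartAt (𝓡 4) p).source := by rwa [extChartAt_source]
  have hl : (extChartAt (𝓡 4) p).symm (extChartAt (𝓡 4) p q) = q := (extChartAt (𝓡 4) p).left_inv hq'
  have hsymm : ContMDiffAt 𝓘(ℝ, R4) (𝓡 4) ∞ (extChartAt (𝓡 4) p).symm (extChartAt (𝓡 4) p q) :=
    (contMDiffOn_extChartAt_symm p).contMDiffAt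
      (extChartAt_target_mem_nhds' ((extChartAt (𝓡 4) p).map_source hq'))
  have hd : MDifferentiableAt 𝓘(ℝ, R4) 𝓘(ℝ, ℝ) (h ∘ (extChartAt (𝓡 4) p).symm)
      (extChartAt (𝓡 4) p q) :=
    MDifferentiableAt.comp _ (by rwa [hl]) (hsymm.mdifferentiableAt (by simp))
  have h1 := mfderiv_comp_apply (I' := 𝓘(ℝ, R4)) q hd (mdifferentiableAt_extChartAt hq)
    (constField p ξ q)
  rw [mfderiv_eq_fderiv, ← tangentTriv_eq_mfderiv hq] at h1
  have h2 : tangentTriv p q (constField p ξ q) = ξ := tangentTriv_symm hq ξ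
  have e : (h ∘ (extChartAt (𝓡 4) p).symm) ∘ extChartAt (𝓡 4) p =ᶠ[𝓝 q] h := by
    filter_upwards [extChartAt_source_mem_nhds' (I := 𝓡 4) hq'] with x hx
    change h ((extChartAt (𝓡 4) p).symm (extChartAt (𝓡 4) p x)) = _
    rw [(extChartAt (𝓡 4) p).left_inv hx]
  have h3 := DFunLike.congr_fun (e.mfderiv_eq (I := 𝓡 4) (I' := 𝓘(ℝ, ℝ))) (constField p ξ q)
  refine h3.symm.trans (h1.trans ?_)
  exact congrArg _ h2

theorem mdifferentiableAt_mvfderiv_constField {p : M} {h : M → ℝ}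
    (hh : ∀ q ∈ (chartAt R4 p).source, ContMDiffAt (𝓡 4) 𝓘(ℝ, ℝ) ∞ h q) (ξ : R4) :
    MDifferentiableAt (𝓡 4) 𝓘(ℝ, ℝ) (fun q ↦ mvfderiv (𝓡 4) h q (constField p ξ q)) p := by
  have hp := mem_chart_source R4 p
  have hl : (extChartAt (𝓡 4) p).symm (extChartAt (𝓡 4) p p) = p := extChartAt_to_inv p
  have hsymm : ContMDiffAt 𝓘(ℝ, R4) (𝓡 4) ∞ (extChartAt (𝓡 4) p).symm (extChartAt (𝓡 4) p p) :=
    (contMDiffOn_extChartAt_symm p).contMDiffAt (extChartAt_target_mem_nhds p)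
  have hc : ContMDiffAt 𝓘(ℝ, R4) 𝓘(ℝ, ℝ) ∞ (h ∘ (extChartAt (𝓡 4) p).symm)
      (extChartAt (𝓡 4) p p) :=
    ContMDiffAt.comp _ (by rw [hl]; exact hh p hp) hsymm
  have h1 : ContDiffAt ℝ 1 (fderiv ℝ (h ∘ (extChartAt (𝓡 4) p).symm)) (extChartAt (𝓡 4) p p) :=
    hc.contDiffAt.fderiv_right (by norm_cast)
  have h2 : DifferentiableAt ℝ (fun y ↦ fderiv ℝ (h ∘ (extChartAt (𝓡 4) p).symm) y ξ)
      (extChartAt (𝓡 4) p p) := (h1.differentiableAt (by simp)).clm_apply (by fun_prop)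
  have h3 := MDifferentiableAt.comp p h2.mdifferentiableAt
    (mdifferentiableAt_extChartAt (I := 𝓡 4) hp)
  refine h3.congr_of_eventuallyEq ?_
  filter_upwards [chart_source_mem_nhds hp] with q hq
  exact mvfderiv_constField hq ((hh q hq).mdifferentiableAt (by simp)) ξ

theorem fieldDiffAt_mlieBracket_constField {p q : M} (hq : q ∈ (chartAt R4 p).source) (ξ η : R4) :
    FieldDiffAt (mlieBracket (𝓡 4) (constField p ξ) (constField p η)) q := by
  have : IsManifold (𝓡 4) (((2 : ℕ∞) : WithTop ℕ∞) + 1) M :=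
    IsManifold.of_le (n := ∞) (by norm_cast)
  have : IsManifold (𝓡 4) (minSmoothness ℝ 2) M := by
    rw [minSmoothness_of_isRCLikeNormedField]
    exact IsManifold.of_le (n := ∞) (by norm_cast)
  have : IsManifold (𝓡 4) (minSmoothness ℝ 3) M := by
    rw [minSmoothness_of_isRCLikeNormedField]
    exact IsManifold.of_le (n := ∞) (by norm_cast)
  have h1 := ContMDiffAt.mlieBracket_vectorField (m := 1) (n := 2)
    ((contMDiffAt_constField hq ξ).of_le (by norm_cast))
    ((contMDiffAt_constField hq η).of_le (by norm_cast)) (by simp; norm_num)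
  exact h1.mdifferentiableAt (by simp)

end ConstField

section Gram

variable {M : Type*} [TopologicalSpace M] [ChartedSpace R4 M] [IsManifold (𝓡 4) ∞ M]
  [RiemannianBundle (fun x : M ↦ TangentSpace (𝓡 4) x)]

/-- The Gram operator `ζ ↦ ∑ i, g(ζ, bᵢ) bᵢ` of the metric in the chart at `p`. -/
def gramCLM (p q : M) : R4 →L[ℝ] R4 :=
  ∑ i, ∑ j, ContinuousLinearMap.smulRight (EuclideanSpace.proj j : R4 →L[ℝ] ℝ)
    ((inner ℝ (constField p (EuclideanSpace.basisFun (Fin 4) ℝ j) q)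
      (constField p (EuclideanSpace.basisFun (Fin 4) ℝ i) q) : ℝ) •
        EuclideanSpace.basisFun (Fin 4) ℝ i)

theorem gramCLM_apply (p q : M) (ζ : R4) :
    gramCLM p q ζ = ∑ i, (inner ℝ (constField p ζ q)
      (constField p (EuclideanSpace.basisFun (Fin 4) ℝ i) q) : ℝ) •
        EuclideanSpace.basisFun (Fin 4) ℝ i := by
  have h1 : constField p ζ q =
      ∑ j, ζ j • constField p (EuclideanSpace.basisFun (Fin 4) ℝ j) q := by
    conv_lhs => rw [← (EuclideanSpace.basisFun (Fin 4) ℝ).sum_repr ζ]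
    rw [constField, map_sum]
    simp only [map_smul]
    rfl
  rw [h1]
  simp only [gramCLM, _root_.sum_apply, ContinuousLinearMap.smulRight_apply, sum_inner,
    real_inner_smul_left, Finset.sum_smul, smul_smul]
  rfl

theorem gramCLM_injective {p q : M} (hq : q ∈ (chartAt R4 p).source) :
    Function.Injective (gramCLM p q) := by
  refine (injective_iff_map_eq_zero _).2 fun ζ hζ ↦ ?_
  rw [gramCLM_apply] at hζ
  have h0 := (Fintype.linearIndependent_iff.1
    (EuclideanSpace.basisFun (Fin 4) ℝ).toBasis.linearIndependent) _ (by simpa using hζ)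
  have h1 : constField p ζ q = ∑ j, ζ j • constField p (EuclideanSpace.basisFun (Fin 4) ℝ j) q := by
    conv_lhs => rw [← (EuclideanSpace.basisFun (Fin 4) ℝ).sum_repr ζ]
    rw [constField, map_sum]
    simp only [map_smul]
    rfl
  have h2 : (inner ℝ (constField p ζ q) (constField p ζ q) : ℝ) = 0 := by
    conv_lhs => arg 3; rw [h1]
    rw [inner_sum]
    refine Finset.sum_eq_zero fun i _ ↦ ?_
    rw [real_inner_smul_right]
    exact mul_eq_zero_of_right _ (by simpa using h0 i)
  have h3 : constField p ζ q = 0 := inner_self_eq_zero.1 h2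
  rw [← tangentTriv_symm hq ζ]
  exact (congrArg _ h3).trans (map_zero _)

end Gram

section Christoffel

variable {M : Type*} [TopologicalSpace M] [ChartedSpace R4 M] [IsManifold (𝓡 4) ∞ M]
  [RiemannianBundle (fun x : M ↦ TangentSpace (𝓡 4) x)]
  [IsContMDiffRiemannianBundle (𝓡 4) ∞ R4 (fun x : M ↦ TangentSpace (𝓡 4) x)]

theorem contMDiffAt_inner_constField {p q : M} (hq : q ∈ (chartAt R4 p).source) (ξ η : R4) :
    ContMDiffAt (𝓡 4) 𝓘(ℝ, ℝ) ∞ (fun q ↦ inner ℝ (constField p ξ q) (constField p η q)) q :=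
  ContMDiffAt.inner_bundle (IB := 𝓡 4) (F := R4) (E := fun x : M ↦ TangentSpace (𝓡 4) x)
    (contMDiffAt_constField hq ξ) (contMDiffAt_constField hq η)

theorem mdifferentiableAt_koszul_constField (p : M) (ξ η ζ : R4) :
    MDifferentiableAt (𝓡 4) 𝓘(ℝ, ℝ)
      (koszul (𝓡 4) (constField p ξ) (constField p η) (constField p ζ)) p := by
  have hp := mem_chart_source R4 p
  have h1 := fun ξ η ζ : R4 ↦ mdifferentiableAt_mvfderiv_constField (p := p)
    (fun q hq ↦ contMDiffAt_inner_constField hq ξ η) ζ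
  have h2 := fun ξ η ζ : R4 ↦ mdiff_inner (fieldDiffAt_mlieBracket_constField hp ξ η)
    (mdifferentiableAt_constField hp ζ)
  exact (((((h1 η ζ ξ).add (h1 ξ ζ η)).sub (h1 ξ η ζ)).add (h2 ξ η ζ)).sub (h2 ξ ζ η)).sub
    (h2 η ζ ξ)

theorem mdifferentiableAt_gramCLM (p : M) :
    MDifferentiableAt (𝓡 4) 𝓘(ℝ, R4 →L[ℝ] R4) (gramCLM p) p := by
  have h1 : MDifferentiableAt (𝓡 4) 𝓘(ℝ, Fin 4 → Fin 4 → ℝ) (fun q i j ↦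
      (inner ℝ (constField p (EuclideanSpace.basisFun (Fin 4) ℝ j) q)
        (constField p (EuclideanSpace.basisFun (Fin 4) ℝ i) q) : ℝ)) p := by
    refine mdifferentiableAt_pi fun i ↦ mdifferentiableAt_pi fun j ↦ ?_
    exact (contMDiffAt_inner_constField (mem_chart_source R4 p) _ _).mdifferentiableAt (by simp)
  have h2 : Differentiable ℝ (fun G : Fin 4 → Fin 4 → ℝ ↦
      ∑ i, ∑ j, ContinuousLinearMap.smulRight (EuclideanSpace.proj j : R4 →L[ℝ] ℝ)
        (G i j • EuclideanSpace.basisFun (Fin 4) ℝ i)) := by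
    fun_prop
  exact h2.differentiableAt.mdifferentiableAt.comp p h1

theorem gramCLM_christoffel {p q : M} (hq : q ∈ (chartAt R4 p).source) (ξ η : R4) :
    gramCLM p q (christoffel p q ξ η) = ∑ i, ((1 / 2 : ℝ) *
      koszul (𝓡 4) (constField p ξ) (constField p η)
        (constField p (EuclideanSpace.basisFun (Fin 4) ℝ i)) q) •
          EuclideanSpace.basisFun (Fin 4) ℝ i := by
  rw [gramCLM_apply]
  refine Finset.sum_congr rfl fun i _ ↦ ?_
  rw [← inner_leviCivitaFun (mdifferentiableAt_constField hq ξ) (mdifferentiableAt_constField hq η)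
    (mdifferentiableAt_constField hq _)]
  have h1 : constField p (christoffel p q ξ η) q =
      leviCivitaFun (constField p η) q (constField p ξ q) := tangentTrivSymm_triv hq _
  rw [h1]

theorem mdifferentiableAt_christoffel (p : M) (ξ η : R4) :
    MDifferentiableAt (𝓡 4) 𝓘(ℝ, R4) (fun q ↦ christoffel p q ξ η) p := by
  have hp := mem_chart_source R4 p
  let e (q : M) (hq : q ∈ (chartAt R4 p).source) : R4 ≃L[ℝ] R4 :=
    (LinearEquiv.ofInjectiveEndo (gramCLM p q).toLinearMap
      (gramCLM_injective hq)).toContinuousLinearEquiv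
  have he (q : M) (hq : q ∈ (chartAt R4 p).source) : (e q hq : R4 →L[ℝ] R4) = gramCLM p q := by
    ext1 v; rfl
  have h1 : MDifferentiableAt (𝓡 4) 𝓘(ℝ, Fin 4 → ℝ) (fun q i ↦
      koszul (𝓡 4) (constField p ξ) (constField p η)
        (constField p (EuclideanSpace.basisFun (Fin 4) ℝ i)) q) p :=
    mdifferentiableAt_pi fun i ↦ mdifferentiableAt_koszul_constField p ξ η _
  have h2 : Differentiable ℝ (fun k : Fin 4 → ℝ ↦
      ∑ i, ((1 / 2 : ℝ) * k i) • EuclideanSpace.basisFun (Fin 4) ℝ i) := by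
    fun_prop
  have h3 := h2.differentiableAt.mdifferentiableAt.comp p h1
  have h4 : DifferentiableAt ℝ ContinuousLinearMap.inverse (gramCLM p p) := by
    rw [← he p hp]
    exact (contDiffAt_map_inverse (n := 1) (e p hp)).differentiableAt (by simp)
  have h5 := h4.mdifferentiableAt.comp p (mdifferentiableAt_gramCLM p)
  refine (h5.clm_apply h3).congr_of_eventuallyEq ?_
  filter_upwards [chart_source_mem_nhds hp] with q hq
  change _ = (gramCLM p q).inverse _
  dsimp only [Function.comp_apply]
  rw [← gramCLM_christoffel hq, ← he q hq, ContinuousLinearMap.inverse_equiv]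
  simp

theorem mdifferentiableAt_christoffelCLM {τ : EndBundle M} {ξ : EndBundle M → R4}
    (hξ : MDifferentiableAt IEnd 𝓘(ℝ, R4) ξ τ) :
    MDifferentiableAt IEnd 𝓘(ℝ, R4 →L[ℝ] R4)
      (fun τ' ↦ christoffelCLM τ.proj τ'.proj (ξ τ')) τ := by
  have h1 : MDifferentiableAt (𝓡 4) 𝓘(ℝ, Fin 4 → Fin 4 → R4) (fun q i j ↦
      christoffel τ.proj q (EuclideanSpace.basisFun (Fin 4) ℝ i)
        (EuclideanSpace.basisFun (Fin 4) ℝ j)) τ.proj :=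
    mdifferentiableAt_pi fun _ ↦ mdifferentiableAt_pi fun _ ↦
      mdifferentiableAt_christoffel τ.proj _ _
  have h2 : MDifferentiableAt IEnd 𝓘(ℝ, Fin 4 → Fin 4 → R4) (fun (τ' : EndBundle M) i j ↦
      christoffel τ.proj τ'.proj (EuclideanSpace.basisFun (Fin 4) ℝ i)
        (EuclideanSpace.basisFun (Fin 4) ℝ j)) τ :=
    MDifferentiableAt.comp τ h1 (contMDiff_proj_endBundle.mdifferentiableAt (by simp))
  have h3 : MDifferentiableAt IEnd 𝓘(ℝ, R4 × (Fin 4 → Fin 4 → R4)) (fun τ' : EndBundle M ↦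
      (ξ τ', fun i j ↦ christoffel τ.proj τ'.proj (EuclideanSpace.basisFun (Fin 4) ℝ i)
        (EuclideanSpace.basisFun (Fin 4) ℝ j))) τ := hξ.prodMk_space h2
  have h4 := differentiable_contractCoeff.differentiableAt.mdifferentiableAt.comp τ h3
  have e : (fun τ' : EndBundle M ↦ christoffelCLM τ.proj τ'.proj (ξ τ')) =
      contractCoeff ∘ fun τ' : EndBundle M ↦
        (ξ τ', fun i j ↦ christoffel τ.proj τ'.proj (EuclideanSpace.basisFun (Fin 4) ℝ i)
          (EuclideanSpace.basisFun (Fin 4) ℝ j)) := rfl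
  rw [e]
  exact h4

end Christoffel

section FibreMap

variable {M : Type*} [TopologicalSpace M] [ChartedSpace R4 M] [IsManifold (𝓡 4) ∞ M]

theorem endCoord_add (p q : M) (a b : EndT q) :
    endCoord p ⟨q, a + b⟩ = endCoord p ⟨q, a⟩ + endCoord p ⟨q, b⟩ := by
  ext1 v; simp [endCoord]

theorem endCoord_sub (p q : M) (a b : EndT q) :
    endCoord p ⟨q, a - b⟩ = endCoord p ⟨q, a⟩ - endCoord p ⟨q, b⟩ := by
  ext1 v; simp [endCoord]

theorem endCoord_smul (p q : M) (c : ℝ) (a : EndT q) :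
    endCoord p ⟨q, c • a⟩ = c • endCoord p ⟨q, a⟩ := by
  ext1 v; simp [endCoord]

theorem endCoord_mul {p q : M} (hq : q ∈ (chartAt R4 p).source) (a b : EndT q) :
    endCoord p ⟨q, a * b⟩ = endCoord p ⟨q, a⟩ * endCoord p ⟨q, b⟩ :=
  endCoord_comp hq a b

theorem endCoord_fNum {p q : M} (hq : q ∈ (chartAt R4 p).source) (l : ℂ) (w s : EndT q) (c : ℝ) :
    endCoord p ⟨q, fNum l w s c⟩ = fNum l (endCoord p ⟨q, w⟩) (endCoord p ⟨q, s⟩) c := by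
  simp only [fNum, endCoord_sub, endCoord_smul, endCoord_mul hq]

theorem endCoord_fDerivNum {p q : M} (hq : q ∈ (chartAt R4 p).source) (l : ℂ) (w s V : EndT q)
    (c k : ℝ) :
    endCoord p ⟨q, fDerivNum l w s c V k⟩ =
      fDerivNum l (endCoord p ⟨q, w⟩) (endCoord p ⟨q, s⟩) c (endCoord p ⟨q, V⟩) k := by
  simp only [fDerivNum, fNumLin, endCoord_sub, endCoord_smul, endCoord_mul hq, endCoord_fNum hq]

theorem endInner_eq_traceInner {p q : M} (hq : q ∈ (chartAt R4 p).source) (a b : EndT q) :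
    endInner a b = traceInner (endCoord p ⟨q, a⟩) (endCoord p ⟨q, b⟩) := by
  have : FiniteDimensional ℝ (TangentSpace (𝓡 4) q) := inferInstanceAs (FiniteDimensional ℝ R4)
  have h1 : (endCoord p ⟨q, a⟩ ∘L endCoord p ⟨q, b⟩).toLinearMap =
      (tangentTriv p q).toLinearMap ∘ₗ ((a ∘L b).toLinearMap ∘ₗ
        (tangentTrivSymm p q).toLinearMap) := by
    rw [← endCoord_comp hq]
    rfl
  have h2 : (tangentTrivSymm p q).toLinearMap ∘ₗ (tangentTriv p q).toLinearMap =
      LinearMap.id := by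
    ext1 v
    exact tangentTrivSymm_triv hq v
  rw [endInner, traceInner, h1, LinearMap.trace_comp_comm', LinearMap.comp_assoc, h2,
    LinearMap.comp_id]

/-- The fibre map `f_λ^-` in coordinates, as a function of `σ` and `ω`. -/
def fCoord (l : ℂ) (x : (R4 →L[ℝ] R4) × (R4 →L[ℝ] R4)) : R4 →L[ℝ] R4 :=
  (fDen l (traceInner x.1 x.2))⁻¹ • fNum l x.2 x.1 (traceInner x.1 x.2)

theorem differentiable_traceInner :
    Differentiable ℝ fun x : (R4 →L[ℝ] R4) × (R4 →L[ℝ] R4) ↦ traceInner x.1 x.2 := by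
  let T : (R4 →L[ℝ] R4) →ₗ[ℝ] ℝ :=
    -(1 / 4 : ℝ) • LinearMap.trace ℝ R4 ∘ₗ ContinuousLinearMap.coeLM ℝ
  have h1 : Differentiable ℝ fun x : (R4 →L[ℝ] R4) × (R4 →L[ℝ] R4) ↦ x.1 ∘L x.2 := by fun_prop
  have h2 := (LinearMap.toContinuousLinearMap T).differentiable.comp h1
  have e : (fun x : (R4 →L[ℝ] R4) × (R4 →L[ℝ] R4) ↦ traceInner x.1 x.2) =
      LinearMap.toContinuousLinearMap T ∘ fun x ↦ x.1 ∘L x.2 := by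
    funext x
    simp [T, traceInner]
  rw [e]
  exact h2

theorem differentiableAt_fCoord {l : ℂ} {x : (R4 →L[ℝ] R4) × (R4 →L[ℝ] R4)}
    (hx : fDen l (traceInner x.1 x.2) ≠ 0) : DifferentiableAt ℝ (fCoord l) x := by
  have h1 := differentiable_traceInner x
  have h2 : DifferentiableAt ℝ (fun x : (R4 →L[ℝ] R4) × (R4 →L[ℝ] R4) ↦
      fDen l (traceInner x.1 x.2)) x := by
    simp only [fDen]; fun_prop
  have h3 : DifferentiableAt ℝ (fun x : (R4 →L[ℝ] R4) × (R4 →L[ℝ] R4) ↦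
      fNum l x.2 x.1 (traceInner x.1 x.2)) x := by
    simp only [fNum]; fun_prop
  exact (h2.inv hx).smul h3

end FibreMap

section FMinus

variable {M : Type*} [TopologicalSpace M] [ChartedSpace R4 M] [IsManifold (𝓡 4) ∞ M]
  [RiemannianBundle (fun x : M ↦ TangentSpace (𝓡 4) x)]
  (h : AlmostHermitianStructure M) (l : ℂ)

theorem fMinus_eq (q : M) (s : EndT q) :
    fMinus h l q s = (fDen l (endInner s (h.J q)))⁻¹ • fNum l (h.J q) s (endInner s (h.J q)) :=
  rfl

theorem mapCoord_fMinus {p : M} {τ : EndBundle M} (hτ : τ.proj ∈ (chartAt R4 p).source) :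
    mapCoord (fMinus h l) p τ =
      fCoord l (endCoord p τ, endCoord p ⟨τ.proj, h.J τ.proj⟩) := by
  rw [mapCoord, fMinus_eq, endCoord_smul, endCoord_fNum hτ, endInner_eq_traceInner hτ]
  rfl

theorem mdifferentiableAt_mapCoord_fMinus {σ : EndBundle M}
    (hD : fDen l (endInner σ.2 (h.J σ.proj)) ≠ 0) :
    MDifferentiableAt IEnd 𝓘(ℝ, R4 →L[ℝ] R4) (mapCoord (fMinus h l) σ.proj) σ := by
  have hσ := mem_chart_source R4 σ.proj
  have h1 : MDifferentiableAt IEnd IEnd (fun τ : EndBundle M ↦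
      (⟨τ.proj, h.J τ.proj⟩ : EndBundle M)) σ :=
    (h.contMDiff.comp contMDiff_proj_endBundle).mdifferentiableAt (by simp)
  have h2 : MDifferentiableAt IEnd 𝓘(ℝ, R4 →L[ℝ] R4)
      (fun τ : EndBundle M ↦ endCoord σ.proj ⟨τ.proj, h.J τ.proj⟩) σ :=
    MDifferentiableAt.comp (I' := IEnd) σ
      (mdifferentiableAt_endCoord (τ := ⟨σ.proj, h.J σ.proj⟩) hσ) h1
  have h3 := (mdifferentiableAt_endCoord hσ).prodMk_space h2
  rw [endInner_eq_traceInner hσ] at hD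
  have h4 := (differentiableAt_fCoord (x := (endCoord σ.proj σ,
    endCoord σ.proj ⟨σ.proj, h.J σ.proj⟩)) hD).mdifferentiableAt.comp σ h3
  refine h4.congr_of_eventuallyEq ?_
  filter_upwards [proj_preimage_chart_mem_nhds hσ] with τ hτ
  exact mapCoord_fMinus h l hτ

/-- The derivative of `f_λ^-` along the fibre. -/
def fMinusDeriv (σ : EndBundle M) (V : EndT σ.proj) : EndT σ.proj :=
  (fDen l (endInner σ.2 (h.J σ.proj)) ^ 2)⁻¹ •
    fDerivNum l (h.J σ.proj) σ.2 (endInner σ.2 (h.J σ.proj)) V (endInner V (h.J σ.proj))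

theorem mfderiv_mapCoord_vertLift {σ : EndBundle M}
    (hD : fDen l (endInner σ.2 (h.J σ.proj)) ≠ 0) (V : EndT σ.proj) :
    mvfderiv IEnd (mapCoord (fMinus h l) σ.proj) σ (vertLift σ V) =
      endCoord σ.proj ⟨σ.proj, fMinusDeriv h l σ V⟩ := by
  have hσ := mem_chart_source R4 σ.proj
  have h1 := mfderiv_comp_apply_of_eq (x := (0 : ℝ)) (y := σ) (I' := IEnd)
    (I'' := 𝓘(ℝ, R4 →L[ℝ] R4)) (f := fun t : ℝ ↦ (⟨σ.proj, σ.2 + t • V⟩ : EndBundle M))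
    (g := mapCoord (fMinus h l) σ.proj)
    (mdifferentiableAt_mapCoord_fMinus h l hD) (mdifferentiableAt_endBundle_fibre σ V) (by simp)
    (1 : ℝ)
  refine h1.symm.trans ?_
  rw [fMinusDeriv, endCoord_smul, endCoord_fDerivNum hσ]
  set c := endInner σ.2 (h.J σ.proj) with hc
  set k := endInner V (h.J σ.proj) with hk
  set W := endCoord σ.proj ⟨σ.proj, h.J σ.proj⟩ with hW
  set S := endCoord σ.proj ⟨σ.proj, σ.2⟩ with hS
  set V' := endCoord σ.proj ⟨σ.proj, V⟩ with hV'
  have e : mapCoord (fMinus h l) σ.proj ∘ (fun t : ℝ ↦ (⟨σ.proj, σ.2 + t • V⟩ : EndBundle M)) =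
      fun t : ℝ ↦ (fDen l (c + t * k))⁻¹ • (fNum l W S c + t • fNumLin l W V' k) := by
    funext t
    have h2 : endInner (σ.2 + t • V) (h.J σ.proj) = c + t * k := by
      rw [hc, hk, endInner_eq_traceInner hσ, endInner_eq_traceInner hσ, endInner_eq_traceInner hσ,
        endCoord_add, endCoord_smul, traceInner_add_left, traceInner_smul_left]
    rw [Function.comp_apply, mapCoord, fMinus_eq]
    dsimp only
    rw [h2, endCoord_smul, endCoord_fNum hσ, endCoord_add, endCoord_smul, fNum_add_smul]
  have h3 : HasDerivAt (fun t : ℝ ↦ fDen l (c + t * k)) ((l.re ^ 2 + l.im ^ 2 - 1) * k) 0 := by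
    simp only [fDen]
    have := ((((hasDerivAt_id (0 : ℝ)).mul_const k).const_add c).const_mul
      (l.re ^ 2 + l.im ^ 2 - 1)).const_add (l.re ^ 2 + l.im ^ 2 + 1)
    simpa using this
  have h4 : HasDerivAt (fun t : ℝ ↦ fNum l W S c + t • fNumLin l W V' k) (fNumLin l W V' k) 0 := by
    simpa using ((hasDerivAt_id (0 : ℝ)).smul_const (fNumLin l W V' k)).const_add (fNum l W S c)
  have h5 := (h3.inv (by simpa using hD)).smul h4
  rw [e, mfderiv_eq_fderiv]
  refine (congrArg (fun L : ℝ →L[ℝ] R4 →L[ℝ] R4 ↦ L 1) h5.hasFDerivAt.fderiv).trans ?_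
  simp only [ContinuousLinearMap.toSpanSingleton_apply, one_smul, zero_mul, add_zero,
    Pi.inv_apply]
  have e1 : (fDen l c ^ 2)⁻¹ * fDen l c = (fDen l c)⁻¹ := by field_simp
  rw [fDerivNum, smul_sub, smul_smul, smul_smul, e1, neg_div, div_eq_inv_mul]
  generalize fNumLin l W V' k = a
  generalize fNum l W S c = b
  module

end FMinus

section Derivative

variable {M : Type*} [TopologicalSpace M] [ChartedSpace R4 M] [IsManifold (𝓡 4) ∞ M]
  [RiemannianBundle (fun x : M ↦ TangentSpace (𝓡 4) x)]
  (h : AlmostHermitianStructure M) {l : ℂ}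

theorem fMinusDeriv_anticomm (hl : l ≠ 0) {σ : EndBundle M} (hσ : σ ∈ twistorSpace h)
    {U : EndT σ.proj} (hU : U ∈ vertSpace σ) (hU0 : U ≠ 0) :
    fDen l (endInner σ.2 (h.J σ.proj)) ≠ 0 ∧
    fMinus h l σ.proj σ.2 ∘L fMinusDeriv h l σ U = -fMinusDeriv h l σ (σ.2 ∘L U) ∧
    ∀ X, X ≠ 0 → fMinusDeriv h l σ (σ.2 ∘L U) X ≠ 0 := by
  obtain ⟨h1, h2, b, b', hb1, hb3, hb'1, hb'3, ho⟩ := hσ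
  obtain ⟨hU1, hU2⟩ := hU
  obtain ⟨k1, k2, k3⟩ := fDerivNum_anticomm (E := TangentSpace (𝓡 4) σ.proj)
    (finrank_euclideanSpace_fin (𝕜 := ℝ) (n := 4)) hl h1 h2 (h.sq σ.proj)
    (h.isometry σ.proj) hb1 hb3 hb'1 hb'3 ho hU1 (fun v ↦ DFunLike.congr_fun hU2 v) hU0
  change 0 < fDen l (endInner σ.2 (h.J σ.proj)) at k1
  refine ⟨k1.ne', ?_, fun X hX ↦ ?_⟩
  · change fNum l (h.J σ.proj) σ.2 (endInner σ.2 (h.J σ.proj)) *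
      fDerivNum l (h.J σ.proj) σ.2 (endInner σ.2 (h.J σ.proj)) U (endInner U (h.J σ.proj)) +
      fDen l (endInner σ.2 (h.J σ.proj)) • fDerivNum l (h.J σ.proj) σ.2
        (endInner σ.2 (h.J σ.proj)) (σ.2 ∘L U) (endInner (σ.2 ∘L U) (h.J σ.proj)) = 0 at k2
    rw [fMinus_eq, fMinusDeriv, fMinusDeriv]
    set D := fDen l (endInner σ.2 (h.J σ.proj))
    generalize fNum l (h.J σ.proj) σ.2 _ = N at k2 ⊢
    generalize fDerivNum l (h.J σ.proj) σ.2 _ U _ = Q at k2 ⊢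
    generalize fDerivNum l (h.J σ.proj) σ.2 _ (σ.2 ∘L U) _ = Q' at k2 ⊢
    change (D⁻¹ • N) * ((D ^ 2)⁻¹ • Q) = -((D ^ 2)⁻¹ • Q')
    rw [smul_mul_smul_comm, eq_neg_of_add_eq_zero_left k2, smul_neg, smul_smul]
    congr 2
    have : D ≠ 0 := k1.ne'
    field_simp
  · change (fDen l (endInner σ.2 (h.J σ.proj)) ^ 2)⁻¹ • (fDerivNum l (h.J σ.proj) σ.2
        (endInner σ.2 (h.J σ.proj)) (σ.2 ∘L U) (endInner (σ.2 ∘L U) (h.J σ.proj)) X) ≠ 0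
    exact smul_ne_zero (by positivity) (k3 X hX)

end Derivative

section Brackets

variable {M : Type*} [TopologicalSpace M] [ChartedSpace R4 M] [IsManifold (𝓡 4) ∞ M]

theorem fieldCoord_endBundle {σ : EndBundle M} (V : Π τ : EndBundle M, TangentSpace IEnd τ) :
    fieldCoord IEnd σ V =ᶠ[𝓝 σ] fun τ ↦ (dBase σ.proj τ (V τ), dEnd σ.proj τ (V τ)) := by
  filter_upwards [proj_preimage_chart_mem_nhds (mem_chart_source R4 σ.proj)] with τ hτ
  exact mfderiv_extChartAt_endBundle hτ _

theorem dBase_mlieBracket {σ : EndBundle M} {V W : Π τ : EndBundle M, TangentSpace IEnd τ}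
    (hV : MDifferentiableAt IEnd 𝓘(ℝ, R4 × (R4 →L[ℝ] R4)) (fieldCoord IEnd σ V) σ)
    (hW : MDifferentiableAt IEnd 𝓘(ℝ, R4 × (R4 →L[ℝ] R4)) (fieldCoord IEnd σ W) σ) :
    dBase σ.proj σ (mlieBracket IEnd V W σ) =
      mvfderiv IEnd (fun τ ↦ dBase σ.proj τ (W τ)) σ (V σ) -
        mvfderiv IEnd (fun τ ↦ dBase σ.proj τ (V τ)) σ (W σ) := by
  have h1 := fieldCoord_mlieBracket hV hW
  rw [(fieldCoord_endBundle _).eq_of_nhds] at h1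
  have h2 : ∀ V : Π τ : EndBundle M, TangentSpace IEnd τ,
      MDifferentiableAt IEnd 𝓘(ℝ, R4 × (R4 →L[ℝ] R4)) (fieldCoord IEnd σ V) σ →
      ∀ w, (mvfderiv IEnd (fieldCoord IEnd σ V) σ w).1 =
        mvfderiv IEnd (fun τ ↦ dBase σ.proj τ (V τ)) σ w := by
    intro V hV w
    have h3 := mfderiv_comp_apply (I' := 𝓘(ℝ, R4 × (R4 →L[ℝ] R4))) (I'' := 𝓘(ℝ, R4)) σ
      (g := Prod.fst) (differentiableAt_fst.mdifferentiableAt) hV w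
    have e : Prod.fst ∘ fieldCoord IEnd σ V =ᶠ[𝓝 σ] fun τ ↦ dBase σ.proj τ (V τ) := by
      filter_upwards [fieldCoord_endBundle V] with τ hτ
      rw [Function.comp_apply, hτ]
    have h4 := DFunLike.congr_fun (e.mfderiv_eq (I := IEnd) (I' := 𝓘(ℝ, R4))) w
    refine Eq.trans ?_ (h3.symm.trans h4)
    rw [mfderiv_eq_fderiv, fderiv_fst]
    rfl
  have h3 := congrArg Prod.fst h1
  rw [Prod.fst_sub, h2 W hW, h2 V hV] at h3
  exact h3

end Brackets

section Nijenhuis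

variable {M : Type*} [TopologicalSpace M] [ChartedSpace R4 M] [IsManifold (𝓡 4) ∞ M]

theorem eventually_dBase_dEnd_extend {σ : EndBundle M} (w : TangentSpace IEnd σ) :
    ∀ᶠ τ in 𝓝 σ, dBase σ.proj τ (FiberBundle.extend (R4 × (R4 →L[ℝ] R4)) w τ) =
        dBase σ.proj σ w ∧
      dEnd σ.proj τ (FiberBundle.extend (R4 × (R4 →L[ℝ] R4)) w τ) = dEnd σ.proj σ w := by
  filter_upwards [fieldCoord_extend (I := IEnd) w, fieldCoord_endBundle (σ := σ)
    (FiberBundle.extend (R4 × (R4 →L[ℝ] R4)) w)] with τ h1 h2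
  have h3 := h2.symm.trans (h1.trans (mfderiv_extChartAt_endBundle
    (mem_chart_source R4 σ.proj) w))
  exact Prod.mk.inj h3

theorem mdifferentiableAt_fieldCoord_extend {σ : EndBundle M} (w : TangentSpace IEnd σ) :
    MDifferentiableAt IEnd 𝓘(ℝ, R4 × (R4 →L[ℝ] R4))
      (fieldCoord IEnd σ (FiberBundle.extend (R4 × (R4 →L[ℝ] R4)) w)) σ :=
  mdifferentiableAt_const.congr_of_eventuallyEq (fieldCoord_extend (I := IEnd) w)

theorem mvfderiv_dBase_extend {σ : EndBundle M} (w v : TangentSpace IEnd σ) :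
    mvfderiv IEnd (fun τ ↦ dBase σ.proj τ (FiberBundle.extend (R4 × (R4 →L[ℝ] R4)) w τ)) σ v =
      0 := by
  have e : (fun τ ↦ dBase σ.proj τ (FiberBundle.extend (R4 × (R4 →L[ℝ] R4)) w τ)) =ᶠ[𝓝 σ]
      fun _ ↦ dBase σ.proj σ w :=
    (eventually_dBase_dEnd_extend w).mono fun _ h ↦ h.1
  have h1 := e.mfderiv_eq (I := IEnd) (I' := 𝓘(ℝ, R4))
  rw [mfderiv_const] at h1
  exact DFunLike.congr_fun h1 v

theorem dBase_mlieBracket_extend_extend {σ : EndBundle M}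
    (a b : TangentSpace IEnd σ) :
    dBase σ.proj σ (mlieBracket IEnd (FiberBundle.extend (R4 × (R4 →L[ℝ] R4)) a) (FiberBundle.extend (R4 × (R4 →L[ℝ] R4)) b) σ) = 0 := by
  rw [dBase_mlieBracket (mdifferentiableAt_fieldCoord_extend a) (mdifferentiableAt_fieldCoord_extend b),
    mvfderiv_dBase_extend, mvfderiv_dBase_extend, sub_zero]

variable [RiemannianBundle (fun x : M ↦ TangentSpace (𝓡 4) x)]
  [IsContMDiffRiemannianBundle (𝓡 4) ∞ R4 (fun x : M ↦ TangentSpace (𝓡 4) x)]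
  {f : Π p : M, EndT p → EndT p}

theorem mdifferentiableAt_fieldCoord_acs {σ : EndBundle M}
    (hf : MDifferentiableAt IEnd 𝓘(ℝ, R4 →L[ℝ] R4) (mapCoord f σ.proj) σ)
    (w : TangentSpace IEnd σ) :
    MDifferentiableAt IEnd 𝓘(ℝ, R4 × (R4 →L[ℝ] R4)) (fieldCoord IEnd σ
      fun τ ↦ acs f τ (FiberBundle.extend (R4 × (R4 →L[ℝ] R4)) w τ)) σ := by
  have hσ := mem_chart_source R4 σ.proj
  have h1 : MDifferentiableAt IEnd 𝓘(ℝ, R4)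
      (fun τ ↦ mapCoord f σ.proj τ (dBase σ.proj σ w)) σ := hf.clm_apply mdifferentiableAt_const
  have h2 := mdifferentiableAt_christoffelCLM h1
  have h3 := mdifferentiableAt_christoffelCLM (τ := σ) (ξ := fun _ ↦ dBase σ.proj σ w)
    mdifferentiableAt_const
  have h4 := mdifferentiableAt_endCoord (p := σ.proj) (τ := σ) hσ
  have h5 := ((h4.clm_comp h2).sub (h2.clm_comp h4)).add (h4.clm_comp
    ((mdifferentiableAt_const (c := dEnd σ.proj σ w)).sub
      ((h4.clm_comp h3).sub (h3.clm_comp h4))))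
  refine (h1.prodMk_space h5).congr_of_eventuallyEq ?_
  filter_upwards [fieldCoord_endBundle (σ := σ)
    (fun τ ↦ acs f τ (FiberBundle.extend (R4 × (R4 →L[ℝ] R4)) w τ)),
    eventually_dBase_dEnd_extend w, proj_preimage_chart_mem_nhds hσ] with τ e1 e2 hτ
  rw [e1, dBase_acs f hτ, dEnd_acs f hτ, e2.1, e2.2]
  rfl

theorem mvfderiv_dBase_acs {σ : EndBundle M}
    (hf : MDifferentiableAt IEnd 𝓘(ℝ, R4 →L[ℝ] R4) (mapCoord f σ.proj) σ)
    (w v : TangentSpace IEnd σ) :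
    mvfderiv IEnd (fun τ ↦ dBase σ.proj τ
        (acs f τ (FiberBundle.extend (R4 × (R4 →L[ℝ] R4)) w τ))) σ v =
      mvfderiv IEnd (mapCoord f σ.proj) σ v (dBase σ.proj σ w) := by
  have e : (fun τ ↦ dBase σ.proj τ (acs f τ (FiberBundle.extend (R4 × (R4 →L[ℝ] R4)) w τ)))
      =ᶠ[𝓝 σ] fun τ ↦ mapCoord f σ.proj τ (dBase σ.proj σ w) := by
    filter_upwards [eventually_dBase_dEnd_extend w,
      proj_preimage_chart_mem_nhds (mem_chart_source R4 σ.proj)] with τ e2 hτ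
    rw [dBase_acs f hτ, e2.1]
  have h1 := DFunLike.congr_fun (e.mfderiv_eq (I := IEnd) (I' := 𝓘(ℝ, R4))) v
  have h2 := mfderiv_comp_apply (I' := 𝓘(ℝ, R4 →L[ℝ] R4)) (I'' := 𝓘(ℝ, R4)) σ
    (g := fun L : R4 →L[ℝ] R4 ↦ L (dBase σ.proj σ w))
    (mdifferentiableAt_iff_differentiableAt.2 (by fun_prop)) hf v
  refine h1.trans (h2.trans ?_)
  rw [mfderiv_eq_fderiv]
  exact DFunLike.congr_fun (ContinuousLinearMap.apply ℝ R4 (dBase σ.proj σ w)).fderiv _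

theorem horLift_zero (τ : EndBundle M) : horLift τ 0 = 0 := by
  have hτ := mem_chart_source R4 τ.proj
  refine ext_dBase_dEnd hτ ?_ ?_
  · rw [dBase_horLift hτ, map_zero]
    exact (map_zero (mfderiv IEnd 𝓘(ℝ, R4) (baseCoord τ.proj) τ)).symm
  · have h0 : christoffelCLM τ.proj τ.proj 0 = 0 := by simp [christoffelCLM]
    rw [dEnd_horLift hτ, map_zero, h0, ContinuousLinearMap.comp_zero,
      ContinuousLinearMap.zero_comp, sub_zero]
    exact (map_zero (mfderiv IEnd 𝓘(ℝ, R4 →L[ℝ] R4) (endCoord τ.proj) τ)).symm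

theorem acs_vertLift (τ : EndBundle M) (V : EndT τ.proj) :
    acs f τ (vertLift τ V) = vertLift τ (τ.2 ∘L V) := by
  rw [acs, projDeriv_vertLift, vertPart, horPart, projDeriv_vertLift, horLift_zero, sub_zero,
    fibreCoord_vertLift, map_zero, horLift_zero, zero_add]

theorem dBase_mlieBracket_acs_acs {σ : EndBundle M}
    (hf : MDifferentiableAt IEnd 𝓘(ℝ, R4 →L[ℝ] R4) (mapCoord f σ.proj) σ)
    (a b : TangentSpace IEnd σ) :
    dBase σ.proj σ (mlieBracket IEnd (fun τ ↦ acs f τ (FiberBundle.extend (R4 × (R4 →L[ℝ] R4)) a τ)) (fun τ ↦ acs f τ (FiberBundle.extend (R4 × (R4 →L[ℝ] R4)) b τ)) σ) =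
      mvfderiv IEnd (mapCoord f σ.proj) σ (acs f σ a) (dBase σ.proj σ b) -
        mvfderiv IEnd (mapCoord f σ.proj) σ (acs f σ b) (dBase σ.proj σ a) := by
  rw [dBase_mlieBracket (mdifferentiableAt_fieldCoord_acs hf a) (mdifferentiableAt_fieldCoord_acs hf b),
    mvfderiv_dBase_acs hf, mvfderiv_dBase_acs hf]
  simp only [FiberBundle.extend_apply_self]

theorem dBase_mlieBracket_acs_extend {σ : EndBundle M}
    (hf : MDifferentiableAt IEnd 𝓘(ℝ, R4 →L[ℝ] R4) (mapCoord f σ.proj) σ)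
    (a b : TangentSpace IEnd σ) :
    dBase σ.proj σ (mlieBracket IEnd (fun τ ↦ acs f τ (FiberBundle.extend (R4 × (R4 →L[ℝ] R4)) a τ)) (FiberBundle.extend (R4 × (R4 →L[ℝ] R4)) b) σ) =
      -mvfderiv IEnd (mapCoord f σ.proj) σ b (dBase σ.proj σ a) := by
  rw [dBase_mlieBracket (mdifferentiableAt_fieldCoord_acs hf a) (mdifferentiableAt_fieldCoord_extend b),
    mvfderiv_dBase_acs hf, mvfderiv_dBase_extend, zero_sub]
  simp only [FiberBundle.extend_apply_self]

theorem dBase_mlieBracket_extend_acs {σ : EndBundle M}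
    (hf : MDifferentiableAt IEnd 𝓘(ℝ, R4 →L[ℝ] R4) (mapCoord f σ.proj) σ)
    (a b : TangentSpace IEnd σ) :
    dBase σ.proj σ (mlieBracket IEnd (FiberBundle.extend (R4 × (R4 →L[ℝ] R4)) a) (fun τ ↦ acs f τ (FiberBundle.extend (R4 × (R4 →L[ℝ] R4)) b τ)) σ) =
      mvfderiv IEnd (mapCoord f σ.proj) σ a (dBase σ.proj σ b) := by
  rw [dBase_mlieBracket (mdifferentiableAt_fieldCoord_extend a) (mdifferentiableAt_fieldCoord_acs hf b),
    mvfderiv_dBase_acs hf, mvfderiv_dBase_extend, sub_zero]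
  simp only [FiberBundle.extend_apply_self]

theorem dBase_nijenhuis {σ : EndBundle M}
    (hf : MDifferentiableAt IEnd 𝓘(ℝ, R4 →L[ℝ] R4) (mapCoord f σ.proj) σ)
    (a b : TangentSpace IEnd σ) :
    dBase σ.proj σ (acsNijenhuis f σ a b) =
      mvfderiv IEnd (mapCoord f σ.proj) σ (acs f σ a) (dBase σ.proj σ b) -
        mvfderiv IEnd (mapCoord f σ.proj) σ (acs f σ b) (dBase σ.proj σ a) +
      mapCoord f σ.proj σ (mvfderiv IEnd (mapCoord f σ.proj) σ b (dBase σ.proj σ a)) -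
      mapCoord f σ.proj σ (mvfderiv IEnd (mapCoord f σ.proj) σ a (dBase σ.proj σ b)) := by
  have hσ := mem_chart_source R4 σ.proj
  have b1 := dBase_mlieBracket_acs_acs hf a b
  have b2 := dBase_mlieBracket_acs_extend hf a b
  have b3 := dBase_mlieBracket_extend_acs hf a b
  have b4 := dBase_mlieBracket_extend_extend a b
  have key : ∀ (B1 B2 B3 B4 : TangentSpace IEnd σ) (x y z : R4),
      dBase σ.proj σ B1 = x → dBase σ.proj σ B2 = -y → dBase σ.proj σ B3 = z →
      dBase σ.proj σ B4 = 0 →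
      dBase σ.proj σ (B1 - acs f σ B2 - acs f σ B3 + acs f σ (acs f σ B4)) =
        x + mapCoord f σ.proj σ y - mapCoord f σ.proj σ z := by
    intro B1 B2 B3 B4 x y z h1 h2 h3 h4
    rw [dBase_add, dBase_sub, dBase_sub, dBase_acs f hσ, dBase_acs f hσ, dBase_acs f hσ,
      dBase_acs f hσ, h1, h2, h3, h4, map_zero, map_zero, map_neg, sub_neg_eq_add, add_zero]
  exact key _ _ _ _ _ _ _ b1 b2 b3 b4

theorem horPart_ne_zero {τ : EndBundle M} {w : TangentSpace IEnd τ} (hw : dBase τ.proj τ w ≠ 0) :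
    horPart τ w ≠ 0 := by
  intro h0
  rw [dBase_eq (mem_chart_source R4 τ.proj), ← projDeriv_horLift τ (projDeriv τ w), ← horPart,
    h0] at hw
  apply hw
  exact (congrArg _ (map_zero (mfderiv IEnd (𝓡 4) (TotalSpace.proj : EndBundle M → M) τ))).trans
    (map_zero _)

theorem horPart_acsNijenhuis_ne_zero (h : AlmostHermitianStructure M) {l : ℂ} (hl : l ≠ 0)
    {σ : EndBundle M} (hσ : σ ∈ twistorSpace h) {X : TangentSpace (𝓡 4) σ.proj} (hX : X ≠ 0)
    {U : EndT σ.proj} (hU : U ∈ vertSpace σ) (hU0 : U ≠ 0) :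
    horPart σ (acsNijenhuis (fMinus h l) σ (horLift σ X) (vertLift σ U)) ≠ 0 := by
  have hp := mem_chart_source R4 σ.proj
  obtain ⟨hD, h1, h2⟩ := fMinusDeriv_anticomm h hl hσ hU hU0
  apply horPart_ne_zero
  rw [dBase_nijenhuis (mdifferentiableAt_mapCoord_fMinus h l hD), dBase_vertLift hp,
    dBase_horLift hp, map_zero, map_zero, map_zero, zero_sub, sub_zero, acs_vertLift,
    mfderiv_mapCoord_vertLift h l hD, mfderiv_mapCoord_vertLift h l hD, mapCoord,
    ← tangentTriv_comp (τ := ⟨σ.proj, fMinusDeriv h l σ U⟩) hp,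
    ← tangentTriv_comp (τ := ⟨σ.proj, fMinus h l σ.proj σ.2⟩) hp,
    ← tangentTriv_comp (τ := ⟨σ.proj, fMinusDeriv h l σ (σ.2 ∘L U)⟩) hp]
  have h3 : fMinus h l σ.proj σ.2 (fMinusDeriv h l σ U X) =
      -fMinusDeriv h l σ (σ.2 ∘L U) X := DFunLike.congr_fun h1 X
  dsimp only
  rw [h3, map_neg, ← neg_add, neg_ne_zero, ← two_smul ℝ]
  refine smul_ne_zero two_ne_zero fun h4 ↦ h2 X hX (tangentTriv_injective hp ?_)
  exact h4.trans (map_zero _).symm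

end Nijenhuis

section SecondDerivative

variable {E F : Type*} [NormedAddCommGroup E] [NormedSpace ℂ E] [NormedAddCommGroup F]
  [NormedSpace ℝ F]

/-- If the differential of `x` intertwines `i` with `G`, then the derivatives of `G` in the kernel of
this differential are complex linear. -/
theorem fderiv_I_smul_of_fderiv_intertwines {x : E → F} {G : E → F →L[ℝ] F} {w₀ : E}
    (hx : ContDiffAt ℝ ∞ x w₀) (hG : DifferentiableAt ℝ G w₀)
    (e : ∀ᶠ w in 𝓝 w₀, ∀ v, fderiv ℝ x w (Complex.I • v) = G w (fderiv ℝ x w v))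
    {u : E} (hu : fderiv ℝ x w₀ u = 0) (v : E) :
    fderiv ℝ G w₀ (Complex.I • u) (fderiv ℝ x w₀ v) =
      G w₀ (fderiv ℝ G w₀ u (fderiv ℝ x w₀ v)) := by
  have hS : DifferentiableAt ℝ (fderiv ℝ x) w₀ :=
    (hx.fderiv_right (m := 1) (by norm_cast)).differentiableAt (by simp)
  have hsymm : IsSymmSndFDerivAt ℝ x w₀ := hx.isSymmSndFDerivAt (by simp; norm_cast)
  have key : ∀ a v, fderiv ℝ (fderiv ℝ x) w₀ a (Complex.I • v) =
      fderiv ℝ G w₀ a (fderiv ℝ x w₀ v) + G w₀ (fderiv ℝ (fderiv ℝ x) w₀ a v) := by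
    intro a v
    have h1 : HasFDerivAt (fun w ↦ fderiv ℝ x w (Complex.I • v)) _ w₀ :=
      hS.hasFDerivAt.clm_apply (hasFDerivAt_const (Complex.I • v) w₀)
    have h2 := hG.hasFDerivAt.clm_apply
      (hS.hasFDerivAt.clm_apply (hasFDerivAt_const v w₀))
    have h3 := DFunLike.congr_fun
      (h1.unique (h2.congr_of_eventuallyEq (e.mono fun w hw ↦ hw v))) a
    simpa [add_comm] using h3
  have k1 := key u v
  have k2 := key (Complex.I • u) v
  have k3 := key v u
  have k4 := key (Complex.I • v) u
  rw [hu, map_zero, zero_add, hsymm.eq v, hsymm.eq v] at k3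
  rw [hu, map_zero, zero_add, hsymm.eq (Complex.I • v), hsymm.eq (Complex.I • v)] at k4
  rw [k4, k1, k3, map_add, add_left_inj] at k2
  exact k2.symm

end SecondDerivative

section Existence

variable {M : Type*} [TopologicalSpace M] [ChartedSpace R4 M]
  [RiemannianBundle (fun x : M ↦ TangentSpace (𝓡 4) x)]

theorem zero_mem_vertSpace (τ : EndBundle M) : (0 : EndT τ.proj) ∈ vertSpace τ := by
  refine ⟨fun v w ↦ ?_, ?_⟩
  · simp
  · simp

end Existence

section NonIntegrability

variable {M : Type*} [TopologicalSpace M] [ChartedSpace R4 M] [IsManifold (𝓡 4) ∞ M]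
  [RiemannianBundle (fun x : M ↦ TangentSpace (𝓡 4) x)]
  [IsContMDiffRiemannianBundle (𝓡 4) ∞ R4 (fun x : M ↦ TangentSpace (𝓡 4) x)]
  {h : AlmostHermitianStructure M} {f : Π p : M, EndT p → EndT p}
  {W : Set (EuclideanSpace ℂ (Fin 3))} {O : Set (EndBundle M)}
  {Ψ : EuclideanSpace ℂ (Fin 3) → EndBundle M}

/-- The integrability condition: the derivative of `f` along the fibre is complex linear. -/
theorem IsHolomorphicParametrization.mvfderiv_mapCoord (H : IsHolomorphicParametrization h f W O Ψ)
    {w₀ : EuclideanSpace ℂ (Fin 3)} (hw₀ : w₀ ∈ W) {σ : EndBundle M} (hσ : Ψ w₀ = σ)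
    (hf : MDifferentiableAt IEnd 𝓘(ℝ, R4 →L[ℝ] R4) (mapCoord f σ.proj) σ)
    (X : TangentSpace (𝓡 4) σ.proj) {U : EndT σ.proj} (hU : U ∈ vertSpace σ) :
    mvfderiv IEnd (mapCoord f σ.proj) σ (vertLift σ (σ.2 ∘L U)) (tangentTriv σ.proj σ.proj X) =
      mapCoord f σ.proj σ (mvfderiv IEnd (mapCoord f σ.proj) σ (vertLift σ U)
        (tangentTriv σ.proj σ.proj X)) := by
  subst hσ
  have hpc : (Ψ w₀).proj ∈ (chartAt R4 (Ψ w₀).proj).source := mem_chart_source R4 _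
  have hΨ : ContMDiffAt 𝓘(ℝ, EuclideanSpace ℂ (Fin 3)) IEnd ∞ Ψ w₀ :=
    H.contMDiffOn.contMDiffAt (H.isOpen_source.mem_nhds hw₀)
  have hx : ContDiffAt ℝ ∞ (baseCoord (Ψ w₀).proj ∘ Ψ) w₀ :=
    ((contMDiffAt_baseCoord hpc).comp w₀ hΨ).contDiffAt
  have hnear : ∀ᶠ w in 𝓝 w₀, w ∈ W ∧ (Ψ w).proj ∈ (chartAt R4 (Ψ w₀).proj).source :=
    (H.isOpen_source.eventually_mem hw₀).and
      (hΨ.continuousAt.eventually (proj_preimage_chart_mem_nhds hpc))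
  have hdx : ∀ w, w ∈ W → (Ψ w).proj ∈ (chartAt R4 (Ψ w₀).proj).source → ∀ v,
      fderiv ℝ (baseCoord (Ψ w₀).proj ∘ Ψ) w v =
        dBase (Ψ w₀).proj (Ψ w) (mfderiv 𝓘(ℝ, EuclideanSpace ℂ (Fin 3)) IEnd Ψ w v) := by
    intro w hw hwp v
    have h1 := mfderiv_comp_apply (I' := IEnd) (I'' := 𝓘(ℝ, R4)) w
      (mdifferentiableAt_baseCoord hwp)
      ((H.contMDiffOn.contMDiffAt (H.isOpen_source.mem_nhds hw)).mdifferentiableAt (by simp)) v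
    rw [mfderiv_eq_fderiv] at h1
    exact h1
  have hG : DifferentiableAt ℝ (mapCoord f (Ψ w₀).proj ∘ Ψ) w₀ :=
    (hf.comp w₀ (hΨ.mdifferentiableAt (by simp))).differentiableAt
  have hdG : ∀ v, fderiv ℝ (mapCoord f (Ψ w₀).proj ∘ Ψ) w₀ v =
      mvfderiv IEnd (mapCoord f (Ψ w₀).proj) (Ψ w₀)
        (mfderiv 𝓘(ℝ, EuclideanSpace ℂ (Fin 3)) IEnd Ψ w₀ v) := by
    intro v
    have h1 := mfderiv_comp_apply (I' := IEnd) (I'' := 𝓘(ℝ, R4 →L[ℝ] R4)) w₀ hf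
      (hΨ.mdifferentiableAt (by simp)) v
    rw [mfderiv_eq_fderiv] at h1
    exact h1
  obtain ⟨u, hu⟩ : ∃ u : EuclideanSpace ℂ (Fin 3),
      mfderiv 𝓘(ℝ, EuclideanSpace ℂ (Fin 3)) IEnd Ψ w₀ u = vertLift (Ψ w₀) U := by
    change vertLift (Ψ w₀) U ∈
      Set.range (mfderiv 𝓘(ℝ, EuclideanSpace ℂ (Fin 3)) IEnd Ψ w₀)
    rw [H.range_eq w₀ hw₀]
    exact ⟨0, U, hU, by rw [horLift_zero, zero_add]⟩
  obtain ⟨v, hv⟩ : ∃ v : EuclideanSpace ℂ (Fin 3),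
      mfderiv 𝓘(ℝ, EuclideanSpace ℂ (Fin 3)) IEnd Ψ w₀ v = horLift (Ψ w₀) X + vertLift (Ψ w₀) 0 := by
    change horLift (Ψ w₀) X + vertLift (Ψ w₀) 0 ∈
      Set.range (mfderiv 𝓘(ℝ, EuclideanSpace ℂ (Fin 3)) IEnd Ψ w₀)
    rw [H.range_eq w₀ hw₀]
    exact ⟨X, 0, zero_mem_vertSpace _, rfl⟩
  have hiu : mfderiv 𝓘(ℝ, EuclideanSpace ℂ (Fin 3)) IEnd Ψ w₀ (Complex.I • u) =
      vertLift (Ψ w₀) ((Ψ w₀).2 ∘L U) := by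
    rw [H.map_I_smul w₀ hw₀, hu, acs_vertLift]
  have du : fderiv ℝ (baseCoord (Ψ w₀).proj ∘ Ψ) w₀ u = 0 := by
    rw [hdx w₀ hw₀ hpc, hu, dBase_vertLift hpc]
  have dv : fderiv ℝ (baseCoord (Ψ w₀).proj ∘ Ψ) w₀ v = tangentTriv (Ψ w₀).proj (Ψ w₀).proj X := by
    rw [hdx w₀ hw₀ hpc, hv, dBase_add, dBase_vertLift hpc, dBase_horLift hpc, add_zero]
  have e : ∀ᶠ w in 𝓝 w₀, ∀ v, fderiv ℝ (baseCoord (Ψ w₀).proj ∘ Ψ) w (Complex.I • v) =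
      (mapCoord f (Ψ w₀).proj ∘ Ψ) w (fderiv ℝ (baseCoord (Ψ w₀).proj ∘ Ψ) w v) := by
    filter_upwards [hnear] with w hw v
    rw [hdx w hw.1 hw.2, hdx w hw.1 hw.2, H.map_I_smul w hw.1, dBase_acs f hw.2]
    rfl
  have k := fderiv_I_smul_of_fderiv_intertwines hx hG e du v
  rw [dv, hdG, hdG, hu, hiu] at k
  exact k

end NonIntegrability

section Existence

variable {E : Type*} [NormedAddCommGroup E] [InnerProductSpace ℝ E]

/-- In dimension four, a compatible complex structure has a unitary basis, and there is a non-zero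
skew-symmetric endomorphism that anti-commutes with it. -/
theorem exists_basis_exists_anticomm (hE : finrank ℝ E = 4) {J : E →L[ℝ] E}
    (h1 : ∀ v, J (J v) = -v) (h2 : ∀ v w, inner ℝ (J v) (J w) = inner ℝ v w) :
    (∃ b : Basis (Fin 4) ℝ E, b 1 = J (b 0) ∧ b 3 = J (b 2)) ∧
      ∃ U : E →L[ℝ] E, (∀ v w, inner ℝ (U v) w = -inner ℝ v (U w)) ∧
        U ∘L J = -(J ∘L U) ∧ U ≠ 0 := by
  have : FiniteDimensional ℝ E := FiniteDimensional.of_finrank_pos (by omega)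
  have hs := skew_of_sq_of_isometry h1 h2
  have hJ := inner_skew_self hs
  have hnJ : ∀ v, ‖J v‖ = ‖v‖ := fun v ↦ by
    rw [← sq_eq_sq₀ (norm_nonneg _) (norm_nonneg _), ← real_inner_self_eq_norm_sq, h2,
      real_inner_self_eq_norm_sq]
  obtain ⟨e, he⟩ : ∃ e : E, ‖e‖ = 1 := by
    have : Nontrivial E := nontrivial_of_finrank_pos (R := ℝ) (by omega)
    exact exists_norm_eq E zero_le_one
  obtain ⟨f, hf, hef, hJef⟩ : ∃ f : E, ‖f‖ = 1 ∧ inner ℝ e f = 0 ∧ inner ℝ (J e) f = 0 := by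
    have hd : finrank ℝ (Submodule.span ℝ {e, J e}) ≤ 2 := by
      classical
      have := finrank_span_finset_le_card (R := ℝ) ({e, J e} : Finset E)
      push_cast at this
      exact this.trans Finset.card_le_two
    have hd' := Submodule.finrank_add_finrank_orthogonal (Submodule.span ℝ {e, J e})
    have : Nontrivial (Submodule.span ℝ {e, J e})ᗮ :=
      nontrivial_of_finrank_pos (R := ℝ) (by omega)
    obtain ⟨⟨f, hf'⟩, hf⟩ := exists_norm_eq (Submodule.span ℝ {e, J e})ᗮ zero_le_one
    exact ⟨f, hf, hf' e (Submodule.subset_span (by simp)),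
      hf' (J e) (Submodule.subset_span (by simp))⟩
  have heJf : inner ℝ e (J f) = 0 := by rw [← neg_eq_zero, ← hs, hJef]
  have ho : Orthonormal ℝ ![e, J e, f, J f] := by
    have s1 : inner ℝ (J e) e = 0 := by rw [real_inner_comm, hJ]
    have s2 : inner ℝ (J f) f = 0 := by rw [real_inner_comm, hJ]
    refine ⟨fun i ↦ ?_, fun i j hij ↦ ?_⟩
    · fin_cases i <;> simp [hnJ, he, hf]
    · fin_cases i <;> fin_cases j <;> first
        | exact absurd rfl hij
        | simp [hJ, h2, hef, hJef, heJf, s1, s2, real_inner_comm e, real_inner_comm (J e)]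
  obtain ⟨β, hβ⟩ := exists_orthonormalBasis_eq hE ho
  refine ⟨⟨β.toBasis, by simp [hβ], by simp [hβ]⟩, ?_⟩
  refine ⟨(innerSL ℝ e).smulRight f - (innerSL ℝ f).smulRight e
    - (innerSL ℝ (J e)).smulRight (J f) + (innerSL ℝ (J f)).smulRight (J e), fun v w ↦ ?_, ?_, ?_⟩
  · simp only [add_apply, sub_apply,
      ContinuousLinearMap.smulRight_apply, innerSL_apply_apply, inner_add_left, inner_sub_left,
      inner_add_right, inner_sub_right, real_inner_smul_left, real_inner_smul_right,
      real_inner_comm v]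
    ring
  · ext v
    simp only [add_apply, sub_apply,
      ContinuousLinearMap.smulRight_apply, innerSL_apply_apply, ContinuousLinearMap.comp_apply,
      neg_apply, map_add, map_sub, map_smul, h1, h2]
    rw [← neg_eq_iff_eq_neg.2 (hs e v), ← neg_eq_iff_eq_neg.2 (hs f v)]
    module
  · intro h0
    have h3 := DFunLike.congr_fun h0 e
    have s1 : inner ℝ f e = 0 := by rw [real_inner_comm, hef]
    have s2 : inner ℝ (J e) e = 0 := by rw [real_inner_comm, hJ]
    have s3 : inner ℝ (J f) e = 0 := by rw [real_inner_comm, heJf]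
    simp [s1, s2, s3, he] at h3
    simp [h3] at hf

end Existence

section NonIntegrability

variable {M : Type*} [TopologicalSpace M] [ChartedSpace R4 M] [IsManifold (𝓡 4) ∞ M]
  [RiemannianBundle (fun x : M ↦ TangentSpace (𝓡 4) x)]
  [IsContMDiffRiemannianBundle (𝓡 4) ∞ R4 (fun x : M ↦ TangentSpace (𝓡 4) x)]

theorem not_isIntegrable_fMinus [Nonempty M] (h : AlmostHermitianStructure M) {l : ℂ}
    (hl : l ≠ 0) : ¬ IsIntegrable h (fMinus h l) := by
  intro hI
  obtain ⟨p⟩ := ‹Nonempty M›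
  obtain ⟨⟨b, hb1, hb3⟩, U, hU1, hU2, hU0⟩ := exists_basis_exists_anticomm
    (E := TangentSpace (𝓡 4) p) (finrank_euclideanSpace_fin (𝕜 := ℝ) (n := 4)) (h.sq p)
    (h.isometry p)
  have hτ : (⟨p, h.J p⟩ : EndBundle M) ∈ twistorSpace h :=
    ⟨h.sq p, h.isometry p, b, b, hb1, hb3, hb1, hb3, rfl⟩
  have hU : U ∈ vertSpace (⟨p, h.J p⟩ : EndBundle M) := ⟨hU1, hU2⟩
  obtain ⟨W, O, Ψ, hO, H⟩ := hI _ hτ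
  obtain ⟨w₀, hw₀, hΨ⟩ := H.bijOn.surjOn ⟨hO, hτ⟩
  have hp := mem_chart_source R4 p
  obtain ⟨hD, h1, h2⟩ := fMinusDeriv_anticomm h hl hτ hU hU0
  have k := H.mvfderiv_mapCoord hw₀ hΨ (mdifferentiableAt_mapCoord_fMinus h l hD) (b 0) hU
  rw [mfderiv_mapCoord_vertLift h l hD, mfderiv_mapCoord_vertLift h l hD, mapCoord,
    ← tangentTriv_comp (τ := ⟨p, fMinusDeriv h l ⟨p, h.J p⟩ U⟩) hp,
    ← tangentTriv_comp (τ := ⟨p, fMinus h l p (h.J p)⟩) hp,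
    ← tangentTriv_comp (τ := ⟨p, fMinusDeriv h l ⟨p, h.J p⟩ (h.J p ∘L U)⟩) hp] at k
  have h3 : fMinus h l p (h.J p) (fMinusDeriv h l ⟨p, h.J p⟩ U (b 0)) =
      -fMinusDeriv h l ⟨p, h.J p⟩ (h.J p ∘L U) (b 0) := DFunLike.congr_fun h1 (b 0)
  have k' := tangentTriv_injective hp k
  dsimp only at k'
  rw [h3] at k'
  rw [eq_neg_iff_add_eq_zero, ← two_smul ℝ] at k'
  exact h2 (b 0) (b.ne_zero 0) ((smul_eq_zero.1 k').resolve_left two_ne_zero)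

end NonIntegrability

end Twistor

end

/-- For every almost Hermitian four-manifold `(M, g, J)` and every `λ ≠ 0`, the horizontal component
of the Nijenhuis tensor `N(X^h, U)` of `𝒥_λ^-` is non-zero for all non-zero `X` and all non-zero
vertical `U`, and `𝒥_λ^-` is not integrable. -/
theorem mainTheorem6 {M : Type*} [TopologicalSpace M] [Nonempty M]
    [ChartedSpace Twistor.R4 M] [IsManifold (𝓡 4) ∞ M]
    [RiemannianBundle (fun x : M ↦ TangentSpace (𝓡 4) x)]
    [IsContMDiffRiemannianBundle (𝓡 4) ∞ Twistor.R4 (fun x : M ↦ TangentSpace (𝓡 4) x)]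
    (h : Twistor.AlmostHermitianStructure M) (l : ℂ) (hl : l ≠ 0) :
    (∀ σ ∈ Twistor.twistorSpace h, ∀ X : TangentSpace (𝓡 4) σ.proj, X ≠ 0 →
      ∀ U ∈ Twistor.vertSpace σ, U ≠ 0 →
        Twistor.horPart σ (Twistor.acsNijenhuis (Twistor.fMinus h l) σ
          (Twistor.horLift σ X) (Twistor.vertLift σ U)) ≠ 0) ∧
    ¬ Twistor.IsIntegrable h (Twistor.fMinus h l) :=
  ⟨fun _ hσ _ hX _ hU hU0 ↦ Twistor.horPart_acsNijenhuis_ne_zero h hl hσ hX hU hU0,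
    Twistor.not_isIntegrable_fMinus h hl⟩
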